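/- **Setting.** Let $T$ be the infinite rooted $d$-ary tree: its vertices are the finite words in the letters $\{0,\dots,d-1\}$, and its level $L(n)$ is the set of words of length $n$. Automorphisms of $T$ act from the right, $v\mapsto v^g$. For $g\in\mathrm{Aut}(T)$ and a vertex $v$, the local cocycle $\beta(g,v)\in\mathrm{Aut}(T)$ is the automorphism with $(vu)^g=v^g\,u^{\beta(g,v)}$ for all words $u$. Let $H\le \mathrm{Sym}(d)$ be a transitive permutation group and let $W(H)$ be the compact group of all $g\in\mathrm{Aut}(T)$ such that, for every vertex $v$, the action of $\beta(g,v)$ on the first level belongs to $H$ (the infinite iterated wreath product of $H$). Let $F=F_m$ be the free group on $x_1,\dots,x_m$. Choose $\phi\in\mathrm{Hom}(F,W(H))\cong W(H)^m$ at random according to the product of the Haar probability measures, and let $F$ act on $T$ through $\phi$. **Theorem 3.1.** Let $\Delta\le F$ be a non-cyclic subgroup and let $K\in\mathbb N$. There exist a random variable $N\in\mathbb N$ and, for every orbit $Z\in L(N)/\Delta$ of $\Delta$ on $L(N)$, a random vertex $v(Z)$ and random elements $\alpha_1(Z),\dots,\alpha_K(Z)\in F$ (all of them measurable functions of $\phi$)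 such that 1. almost surely, for every $Z\in L(N)/\Delta$, one has $v(Z)\in Z$, and $\alpha_k(Z)$ lies in the stabilizer $\Delta_{v(Z)}$ for $1\le k\le K$; 2. for every $Z\in L(N)/\Delta$ the automorphisms $\beta(\alpha_1(Z),v(Z)),\dots,\beta(\alpha_K(Z),v(Z))$ are $K$ independent Haar-random elements of $W(H)$, in the following sense. Let $n\in\mathbb N$, let $\psi\in \mathrm{Hom}(F,W(H))$, and suppose that the event that $N=n$ and that $\phi$ and $\psi$ induce the same action of $F$ on $L(n)$ has positive probability. Let $Z$ be an orbit of $\Delta$ on $L(n)$ for this action. Then, conditionally on this event, the $K$ random elements are independent and each is distributed according to the Haar probability measure of $W(H)$. (No independence is claimed between different orbits.) If moreover $d\ge 2$, then the same $N$, $v(Z)$, $\alpha_k(Z)$ can be taken together with random geometric edges $e_1(Z),\dots,e_K(Z)$ of the Schreier graph $X_N$ of the action of $F$ on $L(N)$ with respect to $x_1,\dots,x_m$ (its geometric edges are the pairs $(x,x_i)$ with $x\in L(N)$ and $1\le i\le m$, where $(x,x_i)$ joins $x$ to $x^{x_i}$), such that almost surely, for every $Z\in L(N)/\Delta$ and all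 $j,k$, the closed path in $X_N$ which starts at $v(Z)$ and is labelled by the reduced word of $\alpha_j(Z)$ in the generators $x_i^{\pm1}$ passes through $e_k(Z)$ exactly once if $j=k$, and not at all if $j\ne k$. -/

import Mathlib

open MeasureTheory ProbabilityTheory

namespace RandomTree

/-! ### The rooted tree and its automorphisms -/

/-- Vertices of the rooted `d`-ary tree: finite words in `d` letters. The root is the empty word,
level `n` consists of the words of length `n`, and `w` is a descendant of `v` when `v` is a prefix
of `w` (written `v <+: w`). -/
abbrev Vertex (d : ℕ) : Type := List (Fin d)

/-- The automorphism group of the rooted tree. It acts from the right, so it is a subgroup of the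
opposite of the group of permutations of the vertices: the product `g * h` is `g` followed
by `h`. -/
def treeAut (d : ℕ) : Subgroup (Equiv.Perm (Vertex d))ᵐᵒᵖ where
  carrier := {g | (∀ v, (g.unop v).length = v.length) ∧
    ∀ v w, v <+: w ↔ g.unop v <+: g.unop w}
  one_mem' := by simp
  mul_mem' := by
    rintro g h ⟨hg, hg'⟩ ⟨hh, hh'⟩
    refine ⟨fun v => ?_, fun v w => ?_⟩
    · simp [hg, hh]
    · rw [hg', hh']; simp
  inv_mem' := by
    rintro g ⟨hg, hg'⟩
    refine ⟨fun v => ?_, fun v w => ?_⟩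
    · simpa using (hg (g.unop⁻¹ v)).symm
    · have := hg' (g.unop⁻¹ v) (g.unop⁻¹ w)
      simpa [Equiv.Perm.inv_def] using this.symm

/-- The image `v ^ g` of the vertex `v` under the tree automorphism `g`. -/
def act {d : ℕ} (g : treeAut d) (v : Vertex d) : Vertex d := g.1.unop v

section

variable {d : ℕ} (g h : treeAut d) (v u : Vertex d)

theorem act_one : act (1 : treeAut d) v = v := rfl

theorem act_mul : act (g * h) v = act h (act g v) := rfl

theorem act_inv_act : act g⁻¹ (act g v) = v := by
  rw [← act_mul, mul_inv_cancel, act_one]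

theorem act_act_inv : act g (act g⁻¹ v) = v := by
  rw [← act_mul, inv_mul_cancel, act_one]

theorem length_act : (act g v).length = v.length := g.2.1 v

theorem prefix_act : v <+: u ↔ act g v <+: act g u := g.2.2 v u

theorem ext_act {g h : treeAut d} (H : ∀ v, act g v = act h v) : g = h :=
  Subtype.ext (MulOpposite.unop_injective (Equiv.ext H))

theorem act_append : act g (v ++ u) = act g v ++ (act g (v ++ u)).drop v.length := by
  obtain ⟨t, ht⟩ := (prefix_act g v (v ++ u)).1 (List.prefix_append v u)
  rw [← ht, List.drop_append_of_le_length (by rw [length_act]),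
    List.drop_eq_nil_of_le (by rw [length_act]), List.nil_append]

end

/-- The local cocycle `β(g, v)`: the action of `g` from the subtree below `v` to the subtree
below `v ^ g`, both identified with the whole tree by deleting the first `Level(v)` letters. Thus
`(v u) ^ g = v ^ g · u ^ β(g, v)` for every word `u`. -/
def localCocycle {d : ℕ} (g : treeAut d) (v : Vertex d) : treeAut d :=
  ⟨MulOpposite.op
    { toFun := fun u => (act g (v ++ u)).drop v.length
      invFun := fun u => (act g⁻¹ (act g v ++ u)).drop v.length
      left_inv := fun u => by
        change (act g⁻¹ (act g v ++ (act g (v ++ u)).drop v.length)).drop v.length = u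
        rw [← act_append, act_inv_act, List.drop_left]
      right_inv := fun u => by
        have := act_append g⁻¹ (act g v) u
        rw [act_inv_act, length_act] at this
        change (act g (v ++ (act g⁻¹ (act g v ++ u)).drop v.length)).drop v.length = u
        rw [← this, act_act_inv, ← length_act g v, List.drop_left] },
    fun u => by simp [length_act], fun u w => by
      change u <+: w ↔ (act g (v ++ u)).drop v.length <+: (act g (v ++ w)).drop v.length
      rw [← List.prefix_append_right_inj v, prefix_act g, act_append g v u, act_append g v w,
        List.prefix_append_right_inj]
      simp [← length_act g v]⟩

theorem act_localCocycle {d : ℕ} (g : treeAut d) (v u : Vertex d) :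
    act g (v ++ u) = act g v ++ act (localCocycle g v) u :=
  act_append g v u

theorem localCocycle_mul {d : ℕ} (g h : treeAut d) (v : Vertex d) :
    localCocycle (g * h) v = localCocycle g v * localCocycle h (act g v) := by
  refine ext_act fun u => List.append_cancel_left (as := act (g * h) v) ?_
  rw [← act_localCocycle, act_mul, act_mul, act_mul, act_localCocycle, act_localCocycle]

theorem localCocycle_localCocycle {d : ℕ} (g : treeAut d) (v w : Vertex d) :
    localCocycle (localCocycle g v) w = localCocycle g (v ++ w) := by
  refine ext_act fun u => List.append_cancel_left (as := act g (v ++ w)) ?_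
  rw [← act_localCocycle, act_localCocycle g v w, List.append_assoc, ← act_localCocycle,
    ← act_localCocycle, List.append_assoc]

theorem localCocycle_one {d : ℕ} (v : Vertex d) : localCocycle (1 : treeAut d) v = 1 := by
  refine ext_act fun u => List.append_cancel_left (as := act (1 : treeAut d) v) ?_
  rw [← act_localCocycle, act_one, act_one, act_one]

/-- The permutation of the letters given by the action of `g` on the first level of the tree:
`[a] ^ g = [rootPerm g a]`. -/
def rootPerm {d : ℕ} (g : treeAut d) : Equiv.Perm (Fin d) where
  toFun a := (act g [a]).head (by simp [← List.length_pos_iff, length_act])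
  invFun a := (act g⁻¹ [a]).head (by simp [← List.length_pos_iff, length_act])
  left_inv a := by
    obtain ⟨b, hb⟩ := List.length_eq_one_iff.1 (length_act g [a])
    have : act g⁻¹ [b] = [a] := by rw [← hb, act_inv_act]
    simp [hb, this]
  right_inv a := by
    obtain ⟨b, hb⟩ := List.length_eq_one_iff.1 (length_act g⁻¹ [a])
    have : act g [b] = [a] := by rw [← hb, act_act_inv]
    simp [hb, this]

theorem act_singleton {d : ℕ} (g : treeAut d) (a : Fin d) : act g [a] = [rootPerm g a] := by
  obtain ⟨b, hb⟩ := List.length_eq_one_iff.1 (length_act g [a])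
  simp [rootPerm, hb]

theorem rootPerm_mul {d : ℕ} (g h : treeAut d) : rootPerm (g * h) = rootPerm h * rootPerm g := by
  ext a
  have := act_singleton (g * h) a
  rw [act_mul, act_singleton, act_singleton] at this
  simpa using congrArg Fin.val (List.singleton_inj.1 this).symm

theorem rootPerm_one {d : ℕ} : rootPerm (1 : treeAut d) = 1 := by
  ext a
  rfl

/-! ### The iterated wreath product -/

/-- The infinite iterated wreath product `W(H)`: the tree automorphisms all of whose `1`-local
cocycles (the actions of `β(g, v)` on the first level) lie in the permutation group `H`. -/
def wreath {d : ℕ} (H : Subgroup (Equiv.Perm (Fin d))) : Subgroup (treeAut d) where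
  carrier := {g | ∀ v, rootPerm (localCocycle g v) ∈ H}
  one_mem' v := by rw [localCocycle_one, rootPerm_one]; exact H.one_mem
  mul_mem' {g h} hg hh v := by
    rw [localCocycle_mul, rootPerm_mul]; exact H.mul_mem (hh _) (hg _)
  inv_mem' {g} hg v := by
    have h := localCocycle_mul g g⁻¹ (act g⁻¹ v)
    rw [mul_inv_cancel, localCocycle_one, act_act_inv] at h
    rw [← inv_eq_of_mul_eq_one_right h.symm]
    have h2 : rootPerm (localCocycle g (act g⁻¹ v))⁻¹ =
        (rootPerm (localCocycle g (act g⁻¹ v)))⁻¹ := by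
      rw [eq_inv_iff_mul_eq_one, ← rootPerm_mul, mul_inv_cancel, rootPerm_one]
    rw [h2]
    exact H.inv_mem (hg _)

/-- The group `W(H)` as a type. -/
def W {d : ℕ} (H : Subgroup (Equiv.Perm (Fin d))) : Type := wreath H

section

variable {d : ℕ} {H : Subgroup (Equiv.Perm (Fin d))}

instance : Group (W H) := inferInstanceAs (Group (wreath H))

/-- The image `v ^ g` of a vertex under an element of `W(H)`. -/
def W.act (g : W H) (v : Vertex d) : Vertex d := RandomTree.act g.1 v

/-- The local cocycle `β(g, v)` of an element of `W(H)`, which lies again in `W(H)`. -/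
def W.cocycle (g : W H) (v : Vertex d) : W H :=
  ⟨localCocycle g.1 v, fun w => by rw [localCocycle_localCocycle]; exact g.2 _⟩

/-- The profinite topology of `W(H)`: pointwise convergence on the (discrete) set of vertices. -/
instance : TopologicalSpace (W H) :=
  TopologicalSpace.induced (fun g : W H => g.act)
    (@Pi.topologicalSpace (Vertex d) (fun _ => Vertex d) (fun _ => ⊥))

theorem W.continuous_iff {X : Type*} [TopologicalSpace X] {f : X → W H} :
    Continuous f ↔ ∀ v w, IsOpen {x | (f x).act v = w} := by
  let _ : TopologicalSpace (Vertex d) := ⊥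
  have _ : DiscreteTopology (Vertex d) := ⟨rfl⟩
  rw [continuous_induced_rng, continuous_pi_iff]
  refine forall_congr' fun v => ?_
  rw [continuous_discrete_rng]
  rfl

theorem W.isOpen_act_eq (v w : Vertex d) : IsOpen {g : W H | g.act v = w} :=
  W.continuous_iff.1 continuous_id v w

instance : IsTopologicalGroup (W H) where
  continuous_mul := by
    refine W.continuous_iff.2 fun v w => ?_
    have : {x : W H × W H | (x.1 * x.2).act v = w} =
        ⋃ u, {g : W H | g.act v = u} ×ˢ {h : W H | h.act u = w} := by
      ext ⟨g, h⟩
      simp only [Set.mem_iUnion, Set.mem_prod, Set.mem_ofPred_eq]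
      exact ⟨fun e => ⟨_, rfl, e⟩, fun ⟨u, e, e'⟩ => by rw [← e', ← e]; rfl⟩
    rw [this]
    exact isOpen_iUnion fun u => (W.isOpen_act_eq v u).prod (W.isOpen_act_eq u w)
  continuous_inv := by
    refine W.continuous_iff.2 fun v w => ?_
    have : {g : W H | (g⁻¹).act v = w} = {g : W H | g.act w = v} := by
      ext g
      simp only [Set.mem_ofPred_eq]
      constructor
      · rintro rfl; exact act_act_inv g.1 v
      · rintro rfl; exact act_inv_act g.1 w
    rw [this]
    exact W.isOpen_act_eq w v

/-- The action on words of a family of permutations of the letters indexed by the vertices. -/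
def portraitAct : (Vertex d → Equiv.Perm (Fin d)) → Vertex d → Vertex d
  | _, [] => []
  | p, a :: u => p [] a :: portraitAct (fun w => p (a :: w)) u

theorem portraitAct_cocycle (g : treeAut d) (u : Vertex d) :
    portraitAct (fun v => rootPerm (localCocycle g v)) u = act g u := by
  induction u generalizing g with
  | nil => exact (List.length_eq_zero_iff.1 (length_act g [])).symm
  | cons a u ih =>
    have h0 : localCocycle g [] = g :=
      ext_act fun u => rfl
    have h1 : act g (a :: u) = act g [a] ++ act (localCocycle g [a]) u :=
      act_localCocycle g [a] u
    rw [portraitAct, h1, act_singleton, ← ih (localCocycle g [a]), h0]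
    simp only [localCocycle_localCocycle, List.singleton_append]

theorem length_portraitAct (p : Vertex d → Equiv.Perm (Fin d)) (u : Vertex d) :
    (portraitAct p u).length = u.length := by
  induction u generalizing p with
  | nil => rfl
  | cons a u ih => simp [portraitAct, ih]

theorem portraitAct_append (p : Vertex d → Equiv.Perm (Fin d)) (v u : Vertex d) :
    portraitAct p (v ++ u) = portraitAct p v ++ portraitAct (fun w => p (v ++ w)) u := by
  induction v generalizing p with
  | nil => rfl
  | cons a v ih => simp [portraitAct, ih]

theorem prefix_portraitAct (p : Vertex d → Equiv.Perm (Fin d)) (v w : Vertex d) :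
    v <+: w ↔ portraitAct p v <+: portraitAct p w := by
  induction v generalizing p w with
  | nil => simp [portraitAct]
  | cons a v ih =>
    cases w with
    | nil => simp [portraitAct]
    | cons b w =>
      simp only [portraitAct, List.cons_prefix_cons, EmbeddingLike.apply_eq_iff_eq]
      constructor
      · rintro ⟨rfl, h⟩; exact ⟨rfl, (ih _ _).1 h⟩
      · rintro ⟨rfl, h⟩; exact ⟨rfl, (ih _ _).2 h⟩

theorem portraitAct_bijective (p : Vertex d → Equiv.Perm (Fin d)) :
    Function.Bijective (portraitAct p) := by
  refine ⟨fun v w h => ?_, fun v => ?_⟩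
  · have h1 := (prefix_portraitAct p v w).2 (h ▸ List.prefix_rfl)
    refine h1.eq_of_length ?_
    rw [← length_portraitAct p v, h, length_portraitAct]
  · induction v generalizing p with
    | nil => exact ⟨[], rfl⟩
    | cons a v ih =>
      obtain ⟨u, hu⟩ := ih (fun w => p ((p []).symm a :: w))
      exact ⟨(p []).symm a :: u, by simp [portraitAct, hu]⟩

/-- The tree automorphism with a prescribed family of `1`-local cocycles. -/
noncomputable def ofPortrait (p : Vertex d → Equiv.Perm (Fin d)) : treeAut d :=
  ⟨MulOpposite.op (Equiv.ofBijective _ (portraitAct_bijective p)),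
    length_portraitAct p, prefix_portraitAct p⟩

theorem act_ofPortrait (p : Vertex d → Equiv.Perm (Fin d)) (v : Vertex d) :
    act (ofPortrait p) v = portraitAct p v := rfl

theorem rootPerm_ofPortrait (p : Vertex d → Equiv.Perm (Fin d)) (v : Vertex d) :
    rootPerm (localCocycle (ofPortrait p) v) = p v := by
  ext a
  have h := act_localCocycle (ofPortrait p) v [a]
  rw [act_ofPortrait, act_ofPortrait, portraitAct_append, act_singleton] at h
  have h2 := List.append_cancel_left h
  simp only [portraitAct, List.append_nil, List.cons.injEq, and_true] at h2
  rw [h2]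

theorem isOpen_portraitAct_eq {X : Type*} [TopologicalSpace X]
    (q : X → Vertex d → Equiv.Perm (Fin d)) (hq : ∀ v a b, IsOpen {x | q x v a = b})
    (v w : Vertex d) : IsOpen {x | portraitAct (q x) v = w} := by
  induction v generalizing q w with
  | nil => simp [portraitAct]
  | cons a v ih =>
    cases w with
    | nil => simp [portraitAct]
    | cons b w =>
      simp only [portraitAct, List.cons.injEq]
      exact (hq [] a b).inter (ih (fun x w => q x (a :: w)) (fun v => hq (a :: v)) w)

instance : CompactSpace (W H) := by
  let _ : TopologicalSpace H := ⊥
  have _ : DiscreteTopology H := ⟨rfl⟩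
  let f : (Vertex d → H) → W H := fun p =>
    ⟨ofPortrait fun v => p v, fun v => by rw [rootPerm_ofPortrait]; exact (p v).2⟩
  have hf : Continuous f := by
    refine W.continuous_iff.2 fun v w =>
      isOpen_portraitAct_eq (fun (p : Vertex d → H) v => (p v : Equiv.Perm (Fin d))) ?_ v w
    intro v a b
    have ho : IsOpen {h : H | (h : Equiv.Perm (Fin d)) a = b} := isOpen_discrete _
    exact ho.preimage (continuous_apply (A := fun _ : Vertex d => H) v)
  have hs : Function.Surjective f := fun g =>
    ⟨fun v => ⟨rootPerm (localCocycle g.1 v), g.2 v⟩,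
      Subtype.ext (ext_act fun u => portraitAct_cocycle g.1 u)⟩
  exact hs.compactSpace hf

instance : MeasurableSpace (W H) := borel (W H)

instance : BorelSpace (W H) := ⟨rfl⟩

end

/-- The Haar probability measure of the compact group `W(H)`. -/
noncomputable def haar {d : ℕ} (H : Subgroup (Equiv.Perm (Fin d))) : Measure (W H) :=
  Measure.haarMeasure ⊤

/-! ### The probability space of random actions of a free group -/

section

variable {d m : ℕ} {H : Subgroup (Equiv.Perm (Fin d))}

/-- The sample space `Hom(F_m, W(H)) = W(H) ^ m`: a homomorphism is given by the images of the
free generators. -/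
abbrev Sample (m : ℕ) {d : ℕ} (H : Subgroup (Equiv.Perm (Fin d))) : Type := Fin m → W H

/-- The product Haar measure on the sample space. -/
noncomputable def law (m : ℕ) {d : ℕ} (H : Subgroup (Equiv.Perm (Fin d))) :
    Measure (Sample m H) :=
  Measure.pi fun _ => haar H

/-- The homomorphism from the free group to `W(H)` with the given images of the generators. -/
def hom (φ : Sample m H) : FreeGroup (Fin m) →* W H := FreeGroup.lift φ

/-- The set `L(n)/Δ` of orbits of `Δ` on the level `n` of the tree, for the action given
by `φ`. -/
def levelOrbits (φ : Sample m H) (Δ : Subgroup (FreeGroup (Fin m))) (n : ℕ) :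
    Set (Set (Vertex d)) :=
  {Z | ∃ x : Vertex d, x.length = n ∧ Z = {y | ∃ δ ∈ Δ, y = (hom φ δ).act x}}

/-- The event that the random level `N` is `n` and that the random action of the free group agrees
on the level `n` of the tree with the action `ψ`. -/
def levelEvent (N : Sample m H → ℕ) (n : ℕ) (ψ : Sample m H) : Set (Sample m H) :=
  {φ | N φ = n ∧ ∀ i, ∀ x : Vertex d, x.length = n → (φ i).act x = (ψ i).act x}

/-- The geometric edges traversed, in this order, by the path in a Schreier graph of the free group
that starts at `x` and has the given word in the free generators and their inverses as its labels
(a letter is `(i, true)` for the generator `x_i` and `(i, false)` for its inverse). A geometric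
edge is a pair of opposite directed edges, `y → y ^ x_i` with label `x_i` and `y ^ x_i → y` with
label `x_i⁻¹`; it is recorded as `(y, i)`. -/
def pathEdges (φ : Sample m H) : Vertex d → List (Fin m × Bool) → List (Vertex d × Fin m)
  | _, [] => []
  | x, (i, true) :: w => (x, i) :: pathEdges φ ((φ i).act x) w
  | x, (i, false) :: w => ((φ i)⁻¹.act x, i) :: pathEdges φ ((φ i)⁻¹.act x) w

end

end RandomTree

open RandomTree

/-! The level `N` is the first one on which no nontrivial reduced word of length at most `R` fixes a
vertex, where the constant `R` depends only on `Δ` and `K`. Such a level exists almost surely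
(`ae_exists_girth`), by induction on `R`. Once words of length at most `R` have no fixed vertices,
the path of a reduced word of length `R + 1` never repeats its first edge. The cocycle of the word
at a fixed vertex is then Haar-random, and the number of fixed vertices on the successive levels is
a martingale. From each value `k ≥ 1` it can jump to `d * k` with a probability bounded below, so it
cannot settle at a positive value and dies out.

Given the action on level `n`, the local cocycles of the generators at its vertices are independent
Haar elements (`lintegral_lev_bfun`). The cocycle of a word is the product of these labels, up to
inversion, along its path (`cocycle_hom`). Hence `K` closed paths have independent Haar cocycles as
soon as each has a private edge, passed exactly once by it and never by the others
(`measurePreserving_ev`).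

It remains to find such paths deterministically, inside every orbit, in graphs of large girth
(`exists_orbit_loops`). As `Δ` is not cyclic, its coset graph contains a finite connected core `C`
of negative Euler characteristic (`exists_core`). In the fibre product of the coset graph with the
level graph, the part above `C` of a component is a finite cover `P` of `C`, and its loops are
labelled by elements of conjugates of `Δ`. Branch vertices are dense in `P`, so a subset with small
boundary that spans a forest has bounded size; any other subset exceeds the girth. In a smallest
large set `A` with small boundary, `K` edges far apart can be cut, with all their lifts, without
separating the vertices next to them: a large piece cut off would contradict minimality, a small one
would be a tree with too few exits (`exists_loops_of_minimal`). Each cut edge therefore closes up to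
a loop that avoids all the other cut edges. -/

namespace RandomTree

/-! ### Walks in Schreier graphs -/

section Walks

open scoped Classical
open Finset

variable {m : ℕ} {X : Type*} (σ : Fin m → Equiv.Perm X)

/-- The inverse of a letter. -/
def flip (s : Fin m × Bool) : Fin m × Bool := (s.1, !s.2)

@[simp] theorem flip_flip (s : Fin m × Bool) : flip (flip s) = s := by simp [flip]

theorem flip_ne (s : Fin m × Bool) : flip s ≠ s := by
  rcases s with ⟨i, b⟩; cases b <;> simp [flip]

/-- The permutation by which a letter acts. -/
def step (s : Fin m × Bool) : Equiv.Perm X := bif s.2 then σ s.1 else (σ s.1)⁻¹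

@[simp] theorem step_flip_step (s : Fin m × Bool) (x : X) : step σ (flip s) (step σ s x) = x := by
  rcases s with ⟨i, b⟩; cases b <;> simp [flip, step]

@[simp] theorem step_step_flip (s : Fin m × Bool) (x : X) : step σ s (step σ (flip s) x) = x := by
  simpa using step_flip_step σ (flip s) x

theorem step_eq_iff (s : Fin m × Bool) (x y : X) : step σ s x = y ↔ step σ (flip s) y = x := by
  constructor <;> rintro rfl <;> simp

/-- The endpoint of the walk that starts at a point and is labelled by a word. -/
def walk : X → List (Fin m × Bool) → X
  | x, [] => x
  | x, s :: w => walk (step σ s x) w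

@[simp] theorem walk_nil (x : X) : walk σ x [] = x := rfl

@[simp] theorem walk_cons (x : X) (s : Fin m × Bool) (w : List (Fin m × Bool)) :
    walk σ x (s :: w) = walk σ (step σ s x) w := rfl

theorem walk_append (x : X) (w w' : List (Fin m × Bool)) :
    walk σ x (w ++ w') = walk σ (walk σ x w) w' := by
  induction w generalizing x with
  | nil => rfl
  | cons s w ih => simp [ih]

theorem invRev_cons' (s : Fin m × Bool) (w : List (Fin m × Bool)) :
    FreeGroup.invRev (s :: w) = FreeGroup.invRev w ++ [flip s] := by
  simp [FreeGroup.invRev, flip]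

@[simp] theorem walk_invRev (x : X) (w : List (Fin m × Bool)) :
    walk σ (walk σ x w) (FreeGroup.invRev w) = x := by
  induction w generalizing x with
  | nil => rfl
  | cons s w ih => rw [invRev_cons', walk_append, walk_cons σ x, ih]; simp

@[simp] theorem walk_walk_invRev (x : X) (w : List (Fin m × Bool)) :
    walk σ (walk σ x (FreeGroup.invRev w)) w = x := by
  simpa [FreeGroup.invRev_invRev] using walk_invRev σ x (FreeGroup.invRev w)

/-- The right action of the free group given by permutations. -/
def rightHom : FreeGroup (Fin m) →* (Equiv.Perm X)ᵐᵒᵖ :=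
  FreeGroup.lift fun i => MulOpposite.op (σ i)

theorem rightHom_mk (w : List (Fin m × Bool)) (x : X) :
    (rightHom σ (FreeGroup.mk w)).unop x = walk σ x w := by
  induction w generalizing x with
  | nil => rfl
  | cons s w ih =>
    have h : FreeGroup.mk (s :: w) = FreeGroup.mk [s] * FreeGroup.mk w := by
      rw [FreeGroup.mul_mk]; rfl
    rw [h, map_mul, MulOpposite.unop_mul, Equiv.Perm.mul_apply, ih, walk_cons]
    congr 1
    rcases s with ⟨i, b⟩
    cases b <;> simp [rightHom, step]

theorem walk_congr {w w' : List (Fin m × Bool)} (h : FreeGroup.mk w = FreeGroup.mk w') (x : X) :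
    walk σ x w = walk σ x w' := by
  rw [← rightHom_mk, h, rightHom_mk]

/-- No nontrivial element of length at most `R` fixes a point. -/
def Girth (R : ℕ) : Prop :=
  ∀ w : List (Fin m × Bool), FreeGroup.IsReduced w → w ≠ [] → w.length ≤ R →
    ∀ x, walk σ x w ≠ x

variable {σ}

theorem Girth.mono {R R' : ℕ} (h : Girth σ R) (hR : R' ≤ R) : Girth σ R' :=
  fun w hw h0 hl => h w hw h0 (hl.trans hR)

theorem Girth.mk_eq_one {R : ℕ} (h : Girth σ R) {w : List (Fin m × Bool)} (hw : w.length ≤ R)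
    {x : X} (hx : walk σ x w = x) : FreeGroup.mk w = 1 := by
  by_contra hne
  refine h (FreeGroup.reduce w) (FreeGroup.isReduced_iff_reduce_eq.2 FreeGroup.reduce.idem) ?_ ?_ x
    ?_
  · rw [← FreeGroup.toWord_mk, Ne, FreeGroup.toWord_eq_nil_iff]; exact hne
  · exact (FreeGroup.norm_mk_le (L₁ := w)).trans hw
  · rw [walk_congr σ (w' := w) FreeGroup.reduce.self, hx]

variable (σ)

/-- The number of letters that lead from a point into a given set. -/
noncomputable def deg (S : Finset X) (p : X) : ℕ := #{s : Fin m × Bool | step σ s p ∈ S}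

/-- The number of directed edges inside a set. -/
noncomputable def totalDeg (S : Finset X) : ℕ := ∑ p ∈ S, deg σ S p

/-- Each geometric edge is counted once from each end, a loop by both of its letters. Parity later
sharpens strict inequalities for Euler characteristics by one more unit. -/
theorem even_totalDeg (S : Finset X) : Even (totalDeg σ S) := by
  have h : ∀ p, deg σ S p = (∑ i, if σ i p ∈ S then 1 else 0) +
      ∑ i, if (σ i)⁻¹ p ∈ S then 1 else 0 := by
    intro p
    rw [deg, card_filter]
    simp only [Fintype.sum_prod_type, Fintype.sum_bool, sum_add_distrib, step,
      cond_true, cond_false]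
    congr!
  simp only [totalDeg, h, sum_add_distrib]
  rw [sum_comm, sum_comm (s := S) (f := fun p i => if (σ i)⁻¹ p ∈ S then 1 else 0)]
  refine ⟨∑ i, ∑ p ∈ S, if σ i p ∈ S then 1 else 0, ?_⟩
  congr 1
  refine sum_congr rfl fun i _ => ?_
  rw [← card_filter, ← card_filter]
  refine card_bij (fun p _ => (σ i)⁻¹ p) ?_ ?_ ?_
  · intro p hp; simp_all
  · intro p _ q _ h; simpa using h
  · intro p hp
    refine ⟨σ i p, ?_, by simp⟩
    simp_all

theorem sum_card_step_eq (S : Finset X) (p : X) :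
    ∑ q ∈ S, #{s : Fin m × Bool | step σ s q = p} = deg σ S p := by
  simp only [deg, card_filter]
  rw [sum_comm]
  refine Fintype.sum_bijective flip
    (Function.Involutive.bijective flip_flip) _ _ fun s => ?_
  simp only [step_eq_iff σ s]
  simp

/-- The directed edges lost are those leaving `p` and those arriving at `p`, equally many. Loops at
`p` belong to both kinds, whence only an inequality. -/
theorem totalDeg_le_erase (S : Finset X) {p : X} (hp : p ∈ S) :
    totalDeg σ S ≤ totalDeg σ (S.erase p) + 2 * deg σ S p := by
  have h1 : totalDeg σ S = deg σ S p + ∑ q ∈ S.erase p, deg σ S q := by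
    rw [totalDeg, add_sum_erase _ _ hp]
  have h2 : ∀ q, deg σ S q ≤ deg σ (S.erase p) q + #{s : Fin m × Bool | step σ s q = p} := by
    intro q
    refine le_trans (card_le_card ?_) (card_union_le _ _)
    intro s hs
    simp only [mem_filter, mem_univ, true_and, mem_union, mem_erase] at hs ⊢
    tauto
  have h3 : ∑ q ∈ S.erase p, #{s : Fin m × Bool | step σ s q = p} ≤ deg σ S p := by
    rw [← sum_card_step_eq]
    exact sum_le_sum_of_subset (erase_subset _ _)
  have h4 := sum_le_sum fun q (_ : q ∈ S.erase p) => h2 q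
  rw [sum_add_distrib] at h4
  rw [h1, totalDeg]
  omega

variable {σ}

/-- In a finite set all of whose points have degree at least two there is a short closed reduced
walk. -/
theorem exists_closed_of_two_le_deg {S : Finset X} (h0 : S.Nonempty) (h : ∀ p ∈ S, 2 ≤ deg σ S p) :
    ¬ Girth σ #S := by
  intro hG
  have hn : ∀ (p : S) (t : Fin m × Bool), ∃ s, s ≠ t ∧ step σ s p ∈ S := by
    intro p t
    obtain ⟨s, hs, hst⟩ := exists_mem_ne (h p p.2) t
    exact ⟨s, hst, by simpa using hs⟩
  choose next hnext hmem using hn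
  obtain ⟨p0, hp0⟩ := h0
  have hm : Nonempty (Fin m × Bool) := by
    have := h p0 hp0
    by_contra hc
    rw [not_nonempty_iff] at hc
    simp [deg] at this
  let t0 : Fin m × Bool := hm.some
  -- An endless walk without backtracking: the state is the current vertex together with the letter
  -- that would undo the last step. Among its first `#S + 1` vertices two coincide, which closes a
  -- reduced walk.
  let f : ℕ → S × (Fin m × Bool) := fun n => Nat.rec (⟨p0, hp0⟩, t0)
    (fun _ x => (⟨step σ (next x.1 x.2) x.1, hmem _ _⟩, flip (next x.1 x.2))) n
  have hf : ∀ n, f (n + 1) = (⟨step σ (next (f n).1 (f n).2) (f n).1, hmem _ _⟩,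
    flip (next (f n).1 (f n).2)) := fun n => rfl
  let wd : ℕ → ℕ → List (Fin m × Bool) := fun k => Nat.rec (fun _ => [])
    (fun _ r n => next (f n).1 (f n).2 :: r (n + 1)) k
  have hwd : ∀ k n, wd (k + 1) n = next (f n).1 (f n).2 :: wd k (n + 1) := fun k n => rfl
  have hwd0 : ∀ n, wd 0 n = [] := fun n => rfl
  clear_value wd f
  have hlen : ∀ k n, (wd k n).length = k := by
    intro k
    induction k with
    | zero => intro n; simp [hwd0]
    | succ k ih => intro n; rw [hwd]; simp [ih]
  have hwalk : ∀ k n, walk σ (f n).1 (wd k n) = (f (n + k)).1 := by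
    intro k
    induction k with
    | zero => intro n; simp [hwd0]
    | succ k ih =>
      intro n
      have := ih (n + 1)
      rw [hf] at this
      rw [hwd, walk_cons, this, add_assoc, add_comm 1 k]
  have hred : ∀ k n, FreeGroup.IsReduced (wd k n) := by
    intro k
    induction k with
    | zero => intro n; rw [hwd0]; exact FreeGroup.IsReduced.nil
    | succ k ih =>
      intro n
      cases k with
      | zero => rw [hwd, hwd0]; exact FreeGroup.IsReduced.singleton
      | succ k =>
        have := ih (n + 1)
        rw [hwd] at this
        rw [hwd, hwd, FreeGroup.isReduced_cons_cons]
        refine ⟨?_, this⟩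
        have h2 := hnext (f (n + 1)).1 (f (n + 1)).2
        intro h3
        by_contra h4
        apply h2
        rw [hf] at *
        refine Prod.ext h3.symm ?_
        simp only [flip]
        exact Bool.eq_not.2 (Ne.symm h4)
  obtain ⟨i, hi, j, hj, hij, he⟩ := exists_ne_map_eq_of_card_lt_of_maps_to
    (s := range (#S + 1)) (t := S) (by simp) (f := fun n => ((f n).1 : X)) (fun n _ => (f n).1.2)
  wlog hlt : i < j generalizing i j
  · exact this j hj i hi hij.symm he.symm (by omega)
  refine hG (wd (j - i) i) (hred _ _) ?_ ?_ (f i).1 ?_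
  · rw [← List.length_pos_iff, hlen]; omega
  · rw [hlen]; simp at hj; omega
  · rw [hwalk, he]; congr 2; congr 1; omega

/-- Below the girth, all sets of vertices span forests. -/
theorem Girth.totalDeg_lt {R : ℕ} (hG : Girth σ R) {S : Finset X} (h0 : S.Nonempty)
    (hS : #S ≤ R) : totalDeg σ S + 2 ≤ 2 * #S := by
  by_contra hc
  have hD : 2 * #S ≤ totalDeg σ S := by
    obtain ⟨k, hk⟩ := even_totalDeg σ S
    omega
  clear hc
  induction hn : #S generalizing S with
  | zero => simp at hn; simp [hn] at h0
  | succ n ih =>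
    by_cases hdeg : ∀ p ∈ S, 2 ≤ deg σ S p
    · exact exists_closed_of_two_le_deg h0 hdeg (hG.mono hS)
    -- Pruning a vertex of degree at most one loses at most two directed edges, so the assumed
    -- inequality passes to the smaller set.
    · push Not at hdeg
      obtain ⟨p, hp, hdp⟩ := hdeg
      have h1 := totalDeg_le_erase σ S hp
      have hc := card_erase_of_mem hp
      rcases (S.erase p).eq_empty_or_nonempty with he | hne
      · have hS1 : S = {p} := by
          rw [erase_eq_empty_iff] at he
          rcases he with he | he
          · simp [he] at hp
          · exact he
        have : totalDeg σ S = deg σ S p := by simp [totalDeg, hS1]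
        omega
      · exact ih hne (by omega) (by omega) (by omega)

end Walks

/-! ### Finite cores of negative Euler characteristic in coset graphs -/

section Cores

open scoped Classical
open Finset

variable {m : ℕ} {X : Type*} (σ : Fin m → Equiv.Perm X)

/-- All steps of a walk satisfy a given condition. -/
def Along (r : X → Fin m × Bool → Prop) : X → List (Fin m × Bool) → Prop
  | _, [] => True
  | x, s :: w => r x s ∧ Along r (step σ s x) w

variable {σ}

theorem Along.append {r : X → Fin m × Bool → Prop} {x : X} {w w' : List (Fin m × Bool)}
    (h : Along σ r x w) (h' : Along σ r (walk σ x w) w') : Along σ r x (w ++ w') := by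
  induction w generalizing x with
  | nil => exact h'
  | cons s w ih => exact ⟨h.1, ih h.2 h'⟩

theorem Along.mono {r r' : X → Fin m × Bool → Prop} {x : X} {w : List (Fin m × Bool)}
    (h : Along σ r x w) (hr : ∀ p s, r p s → r' p s) : Along σ r' x w := by
  induction w generalizing x with
  | nil => trivial
  | cons s w ih => exact ⟨hr _ _ h.1, ih h.2⟩

/-- A finite set of vertices whose Euler characteristic is negative contains a connected core. -/
theorem exists_core {S : Finset X} (hS : 2 * #S + 2 ≤ totalDeg σ S) :
    ∃ C : Finset X, (∀ p ∈ C, 2 ≤ deg σ C p) ∧ ∃ c₀ ∈ C, 3 ≤ deg σ C c₀ ∧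
      ∀ c ∈ C, ∃ w, Along σ (fun p s => step σ s p ∈ C) c w ∧ walk σ c w = c₀ := by
  -- A smallest set of negative Euler characteristic works. Deleting a vertex of degree at most one,
  -- or keeping one of two unconnected parts, would give a smaller one; a vertex of degree three
  -- exists because the average degree exceeds two.
  obtain ⟨C, hC, hmin⟩ := WellFounded.has_min (measure (fun S : Finset X => #S)).wf
    {S : Finset X | 2 * #S + 2 ≤ totalDeg σ S} ⟨S, hS⟩
  replace hC : 2 * #C + 2 ≤ totalDeg σ C := hC
  replace hmin : ∀ T : Finset X, #T < #C → totalDeg σ T ≤ 2 * #T := by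
    intro T hT
    have h1 : ¬ (2 * #T + 2 ≤ totalDeg σ T) := fun h => hmin T h hT
    obtain ⟨k, hk⟩ := even_totalDeg σ T
    omega
  obtain ⟨c₀, hc₀, h3⟩ : ∃ c₀ ∈ C, 2 < deg σ C c₀ :=
    exists_lt_of_sum_lt (by rw [sum_const, smul_eq_mul, ← totalDeg]; omega)
  refine ⟨C, ?_, c₀, hc₀, h3, ?_⟩
  · intro p hp
    by_contra hlt
    have h1 := totalDeg_le_erase σ C hp
    have h2 := card_erase_of_mem hp
    have h4 := card_pos.2 ⟨p, hp⟩
    have := hmin (C.erase p) (by omega)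
    omega
  · by_contra hcon
    push Not at hcon
    obtain ⟨c, hc, hcw⟩ := hcon
    let C₁ := C.filter fun c => ∃ w, Along σ (fun p s => step σ s p ∈ C) c w ∧ walk σ c w = c₀
    let C₂ := C.filter fun c => ¬ ∃ w, Along σ (fun p s => step σ s p ∈ C) c w ∧ walk σ c w = c₀
    have hsum : #C₁ + #C₂ = #C := card_filter_add_card_filter_not _
    have hp₁ : 0 < #C₁ := card_pos.2 ⟨c₀, mem_filter.2 ⟨hc₀, [], trivial, rfl⟩⟩
    have hp₂ : 0 < #C₂ := card_pos.2 ⟨c, mem_filter.2 ⟨hc, by push Not; exact hcw⟩⟩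
    have hd : totalDeg σ C = totalDeg σ C₁ + totalDeg σ C₂ := by
      rw [totalDeg, ← sum_filter_add_sum_filter_not C
        (fun c => ∃ w, Along σ (fun p s => step σ s p ∈ C) c w ∧ walk σ c w = c₀)]
      congr 1
      · refine sum_congr rfl fun p hp => congrArg card (filter_congr fun s _ => ?_)
        simp only [C₁, mem_filter] at hp ⊢
        obtain ⟨hpC, w, hw, hwp⟩ := hp
        exact ⟨fun h => ⟨h, flip s :: w, ⟨by simpa, by simpa using hw⟩, by simpa using hwp⟩,
          fun h => h.1⟩
      · refine sum_congr rfl fun p hp => congrArg card (filter_congr fun s _ => ?_)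
        simp only [C₂, mem_filter] at hp ⊢
        refine ⟨fun h => ⟨h, ?_⟩, fun h => h.1⟩
        rintro ⟨w, hw, hwp⟩
        exact hp.2 ⟨s :: w, ⟨h, hw⟩, hwp⟩
    have := hmin C₁ (by omega)
    have := hmin C₂ (by omega)
    omega

variable (σ)

/-- The number of directed edges in a set that are compatible with a labelling of the vertices by
elements of the free group. -/
noncomputable def treeDeg (S : Finset X) (ω : X → FreeGroup (Fin m)) : ℕ :=
  ∑ p ∈ S, #{s : Fin m × Bool | step σ s p ∈ S ∧ ω p * FreeGroup.mk [s] = ω (step σ s p)}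

variable {σ}

theorem mk_flip (s : Fin m × Bool) : FreeGroup.mk [flip s] = (FreeGroup.mk [s])⁻¹ := by
  rw [FreeGroup.inv_mk]; rfl

/-- The new vertex gets the label that makes the edge leading to it compatible in both directions,
and the old labels are kept. -/
theorem treeDeg_insert {S : Finset X} {ω : X → FreeGroup (Fin m)}
    {p : X} (hp : p ∈ S) {s : Fin m × Bool} (hs : step σ s p ∉ S) :
    treeDeg σ S ω + 2 ≤ treeDeg σ (insert (step σ s p) S)
      (Function.update ω (step σ s p) (ω p * FreeGroup.mk [s])) := by
  set ω' := Function.update ω (step σ s p) (ω p * FreeGroup.mk [s]) with hω'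
  have hω : ∀ q ∈ S, ω' q = ω q := fun q hq =>
    Function.update_of_ne (fun h => hs (by rwa [h] at hq)) _ _
  have hnew : ω' (step σ s p) = ω p * FreeGroup.mk [s] := Function.update_self _ _ _
  rw [treeDeg, treeDeg, sum_insert hs]
  have h1 : 1 ≤ #{t : Fin m × Bool | step σ t (step σ s p) ∈ insert (step σ s p) S ∧
      ω' (step σ s p) * FreeGroup.mk [t] = ω' (step σ t (step σ s p))} := by
    refine card_pos.2 ⟨flip s, ?_⟩
    rw [mem_filter]
    simp only [mem_univ, true_and, step_flip_step, hnew, hω p hp, mk_flip]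
    exact ⟨mem_insert_of_mem hp, by group⟩
  have hsub : ∀ q ∈ S,
      ({t : Fin m × Bool | step σ t q ∈ S ∧ ω q * FreeGroup.mk [t] = ω (step σ t q)} :
        Finset (Fin m × Bool)) ⊆
      ({t : Fin m × Bool | step σ t q ∈ insert (step σ s p) S ∧
        ω' q * FreeGroup.mk [t] = ω' (step σ t q)} : Finset (Fin m × Bool)) := by
    intro q hq t ht
    simp only [mem_filter, mem_univ, true_and, mem_insert] at ht ⊢
    exact ⟨Or.inr ht.1, by rw [hω q hq, hω _ ht.1, ht.2]⟩
  have h2 : ∑ q ∈ S, #{t : Fin m × Bool | step σ t q ∈ S ∧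
        ω q * FreeGroup.mk [t] = ω (step σ t q)} <
      ∑ q ∈ S, #{t : Fin m × Bool | step σ t q ∈ insert (step σ s p) S ∧
        ω' q * FreeGroup.mk [t] = ω' (step σ t q)} := by
    refine sum_lt_sum (fun q hq => card_le_card (hsub q hq)) ⟨p, hp, card_lt_card ?_⟩
    refine Finset.ssubset_iff_subset_ne.2 ⟨hsub p hp, fun he => ?_⟩
    have : s ∈ ({t : Fin m × Bool | step σ t p ∈ S ∧
        ω p * FreeGroup.mk [t] = ω (step σ t p)} : Finset (Fin m × Bool)) := by
      rw [he]
      simp [hω p hp, hnew]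
    exact hs (by simpa using this : _ ∧ _).1
  omega

/-- The invariant says that there are at least as many compatible directed edges as in a spanning
tree. Following the walk, every new vertex is attached by a compatible edge. -/
theorem exists_tree_extension (w : List (Fin m × Bool)) {S : Finset X}
    {ω : X → FreeGroup (Fin m)} {p : X} (hp : p ∈ S) (h : 2 * #S ≤ treeDeg σ S ω + 2) :
    ∃ (S' : Finset X) (ω' : X → FreeGroup (Fin m)), S ⊆ S' ∧ 2 * #S' ≤ treeDeg σ S' ω' + 2 ∧
      Along σ (fun q s => step σ s q ∈ S') p w := by
  induction w generalizing S ω p with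
  | nil => exact ⟨S, ω, Subset.rfl, h, trivial⟩
  | cons s w ih =>
    by_cases hs : step σ s p ∈ S
    · obtain ⟨S', ω', h1, h2, h3⟩ := ih hs h
      exact ⟨S', ω', h1, h2, h1 hs, h3⟩
    · have h4 := treeDeg_insert (ω := ω) hp hs
      obtain ⟨S', ω', h1, h2, h3⟩ := ih (mem_insert_self (step σ s p) S)
        (ω := Function.update ω (step σ s p) (ω p * FreeGroup.mk [s]))
        (by rw [card_insert_of_notMem hs]; omega)
      exact ⟨S', ω', (subset_insert _ _).trans h1, h2, h1 (mem_insert_self _ _), h3⟩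

/-- The element `ω p * mk w * (ω q)⁻¹` attached to a walk from `p` to `q` is multiplicative under
concatenation, so it suffices to control single edges. -/
theorem zpowers_of_along {S : Finset X} {ω : X → FreeGroup (Fin m)} {t : FreeGroup (Fin m)}
    (ht : ∀ p ∈ S, ∀ s, step σ s p ∈ S →
      ω p * FreeGroup.mk [s] * (ω (step σ s p))⁻¹ ∈ Subgroup.zpowers t)
    (w : List (Fin m × Bool)) {p : X} (hp : p ∈ S)
    (hw : Along σ (fun q s => step σ s q ∈ S) p w) :
    ω p * FreeGroup.mk w * (ω (walk σ p w))⁻¹ ∈ Subgroup.zpowers t := by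
  induction w generalizing p with
  | nil =>
    have h1 : (FreeGroup.mk [] : FreeGroup (Fin m)) = 1 := rfl
    simp [h1]
  | cons s w ih =>
    have h := mul_mem (ht p hp s hw.1) (ih hw.1 hw.2)
    have h1 : FreeGroup.mk (s :: w) = FreeGroup.mk [s] * FreeGroup.mk w := by
      rw [FreeGroup.mul_mk]; rfl
    rw [walk_cons, h1]
    convert h using 1
    group

/-- A Schreier graph in which two closed walks do not commute has a finite part with negative
Euler characteristic. -/
theorem exists_two_mul_card_add_two_le {y : X} {g h : FreeGroup (Fin m)} (hg : walk σ y g.toWord = y)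
    (hh : walk σ y h.toWord = y) (hgh : g * h ≠ h * g) :
    ∃ S : Finset X, 2 * #S + 2 ≤ totalDeg σ S := by
  obtain ⟨S₁, ω₁, h1, h2, hw1⟩ := exists_tree_extension (σ := σ) g.toWord (mem_singleton_self y)
    (ω := 1) (by simp)
  obtain ⟨S, ω, h3, h4, hw2⟩ := exists_tree_extension (σ := σ) h.toWord (h1 (mem_singleton_self y)) h2
  have hy : y ∈ S := h3 (h1 (mem_singleton_self y))
  replace hw1 := hw1.mono (r' := fun q s => step σ s q ∈ S) fun q s hq => h3 hq
  refine ⟨S, ?_⟩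
  by_contra hlt
  have hle : totalDeg σ S ≤ 2 * #S := by
    obtain ⟨k, hk⟩ := even_totalDeg σ S
    omega
  let nt : Finset ((_ : X) × (Fin m × Bool)) := S.sigma fun p =>
    {s : Fin m × Bool | step σ s p ∈ S ∧ ¬ ω p * FreeGroup.mk [s] = ω (step σ s p)}
  -- With at most `2 * #S` directed edges in all and at least `2 * #S - 2` compatible ones, at most
  -- one geometric edge lies outside the tree. The fundamental group is then cyclic, which forces
  -- `g` and `h` to commute.
  have hnt : #nt ≤ 2 := by
    have : totalDeg σ S = treeDeg σ S ω + #nt := by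
      rw [card_sigma, totalDeg, treeDeg, ← sum_add_distrib]
      refine sum_congr rfl fun p _ => ?_
      rw [deg, ← card_filter_add_card_filter_not
        (fun s => ω p * FreeGroup.mk [s] = ω (step σ s p)), filter_filter, filter_filter]
    omega
  obtain ⟨t, ht⟩ : ∃ t : FreeGroup (Fin m), ∀ p ∈ S, ∀ s, step σ s p ∈ S →
      ω p * FreeGroup.mk [s] * (ω (step σ s p))⁻¹ ∈ Subgroup.zpowers t := by
    have htriv : ∀ (t : FreeGroup (Fin m)) p s, ω p * FreeGroup.mk [s] = ω (step σ s p) →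
        ω p * FreeGroup.mk [s] * (ω (step σ s p))⁻¹ ∈ Subgroup.zpowers t := by
      intro t p s h
      rw [h, mul_inv_cancel]
      exact one_mem _
    rcases nt.eq_empty_or_nonempty with he | ⟨⟨p, s⟩, hps⟩
    · refine ⟨1, fun p hp s hs => htriv _ _ _ ?_⟩
      by_contra hc
      have : (⟨p, s⟩ : (_ : X) × (Fin m × Bool)) ∈ nt := by simp [nt, hp, hs, hc]
      simp [he] at this
    · refine ⟨ω p * FreeGroup.mk [s] * (ω (step σ s p))⁻¹, fun q hq r hr => ?_⟩
      by_cases hqr : ω q * FreeGroup.mk [r] = ω (step σ r q)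
      · exact htriv _ _ _ hqr
      -- The reverse of an incompatible edge is incompatible, so `nt` consists of one edge in its
      -- two directions, contributing `t` and its inverse.
      have hps' : (⟨step σ s p, flip s⟩ : (_ : X) × (Fin m × Bool)) ∈ nt := by
        simp only [nt, mem_sigma, mem_filter, mem_univ, true_and, step_flip_step] at hps ⊢
        refine ⟨hps.2.1, hps.1, fun h => hps.2.2 ?_⟩
        rw [← h, mk_flip]
        group
      have hqr' : (⟨q, r⟩ : (_ : X) × (Fin m × Bool)) ∈ nt := by simp [nt, hq, hr, hqr]
      have hpair : nt = {⟨p, s⟩, ⟨step σ s p, flip s⟩} := by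
        refine (eq_of_subset_of_card_le ?_ ?_).symm
        · intro x hx
          rw [mem_insert, mem_singleton] at hx
          rcases hx with rfl | rfl <;> assumption
        · rw [card_pair]
          · exact hnt
          · intro h
            have := (Sigma.mk.inj_iff.1 h).2
            exact flip_ne s (eq_of_heq this).symm
      rw [hpair, mem_insert, mem_singleton] at hqr'
      rcases hqr' with h | h
      · obtain ⟨rfl, h'⟩ := Sigma.mk.inj_iff.1 h
        obtain rfl := eq_of_heq h'
        exact Subgroup.mem_zpowers _
      · obtain ⟨rfl, h'⟩ := Sigma.mk.inj_iff.1 h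
        obtain rfl := eq_of_heq h'
        rw [← inv_mem_iff, step_flip_step, mk_flip]
        convert Subgroup.mem_zpowers _ using 1
        group
  have k1 := zpowers_of_along ht _ hy hw1
  have k2 := zpowers_of_along ht _ hy hw2
  rw [hg, FreeGroup.mk_toWord] at k1
  rw [hh, FreeGroup.mk_toWord] at k2
  obtain ⟨a, ha⟩ := k1
  obtain ⟨b, hb⟩ := k2
  simp only at ha hb
  have hab : (ω y * g * (ω y)⁻¹) * (ω y * h * (ω y)⁻¹) =
      (ω y * h * (ω y)⁻¹) * (ω y * g * (ω y)⁻¹) := by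
    rw [← ha, ← hb, ← zpow_add, ← zpow_add, add_comm]
  apply hgh
  have := congrArg (fun z => (ω y)⁻¹ * z * ω y) hab
  simpa [mul_assoc] using this

/-- By Nielsen–Schreier `Δ` is free. With at most one generator it is cyclic; two distinct free
generators can be sent to two transpositions of three points that do not commute. -/
theorem exists_not_commute {α : Type*} {Δ : Subgroup (FreeGroup α)} (hΔ : ¬ IsCyclic Δ) :
    ∃ g ∈ Δ, ∃ h ∈ Δ, g * h ≠ h * g := by
  by_cases hs : Subsingleton (IsFreeGroup.Generators Δ)
  · exfalso
    apply hΔ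
    let e := IsFreeGroup.mulEquiv Δ
    rcases isEmpty_or_nonempty (IsFreeGroup.Generators Δ) with he | hne
    · have : Subsingleton Δ := e.symm.injective.subsingleton
      infer_instance
    · have : Unique (IsFreeGroup.Generators Δ) := uniqueOfSubsingleton hne.some
      exact isCyclic_of_surjective e.toMonoidHom e.surjective
  · rw [not_subsingleton_iff_nontrivial] at hs
    obtain ⟨a, b, hab⟩ := exists_pair_ne (IsFreeGroup.Generators Δ)
    refine ⟨_, (IsFreeGroup.of (G := Δ) a).2, _, (IsFreeGroup.of (G := Δ) b).2, ?_⟩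
    intro h
    have h' : IsFreeGroup.of a * IsFreeGroup.of b = IsFreeGroup.of b * IsFreeGroup.of a :=
      Subtype.ext h
    have h2 := congrArg (IsFreeGroup.lift fun c =>
      if c = a then Equiv.swap (0 : Fin 3) 1 else Equiv.swap 1 2) h'
    simp only [map_mul, IsFreeGroup.lift_of, if_true, hab.symm, if_false] at h2
    revert h2
    decide

end Cores

/-! ### Geometric edges traversed by walks -/

section Edges

open scoped Classical
open Finset

variable {m : ℕ} {X : Type*} (σ : Fin m → Equiv.Perm X)

/-- The geometric edge traversed from a vertex along a letter. -/
def geo (x : X) (s : Fin m × Bool) : X × Fin m := (bif s.2 then x else step σ s x, s.1)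

/-- The geometric edges traversed by a walk. -/
def edges : X → List (Fin m × Bool) → List (X × Fin m)
  | _, [] => []
  | x, s :: w => geo σ x s :: edges (step σ s x) w

variable {σ}

theorem geo_flip (x : X) (s : Fin m × Bool) : geo σ (step σ s x) (flip s) = geo σ x s := by
  rcases s with ⟨i, b⟩
  cases b <;> simp [geo, flip, step]

theorem geo_eq_geo {x y : X} {s t : Fin m × Bool} (h : geo σ x s = geo σ y t) :
    (y = x ∧ t = s) ∨ (y = step σ s x ∧ t = flip s) := by
  rcases s with ⟨i, b⟩
  rcases t with ⟨j, c⟩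
  cases b <;> cases c <;> simp_all [geo, flip, step, eq_comm]
  obtain ⟨h, rfl⟩ := h
  exact Equiv.injective _ h

theorem edges_append (x : X) (w w' : List (Fin m × Bool)) :
    edges σ x (w ++ w') = edges σ x w ++ edges σ (walk σ x w) w' := by
  induction w generalizing x with
  | nil => rfl
  | cons s w ih => simp [edges, ih]

theorem edges_invRev (x : X) (w : List (Fin m × Bool)) :
    edges σ (walk σ x w) (FreeGroup.invRev w) = (edges σ x w).reverse := by
  induction w generalizing x with
  | nil => rfl
  | cons s w ih =>
    rw [invRev_cons', edges_append, walk_cons σ x, ih, walk_invRev]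
    simp [edges, geo_flip]

/-- A cancelled pair of letters passes twice through the same geometric edge. Hence a count of zero
or one survives reduction. -/
theorem count_edges_reduce (x : X) (w : List (Fin m × Bool)) (e : X × Fin m) :
    ∃ k, (edges σ x w).count e = (edges σ x (FreeGroup.reduce w)).count e + 2 * k := by
  have h : FreeGroup.Red w (FreeGroup.reduce w) := FreeGroup.reduce.red
  generalize FreeGroup.reduce w = w' at h
  induction h with
  | refl => exact ⟨0, rfl⟩
  | tail _ hs ih =>
    obtain ⟨k, hk⟩ := ih
    cases hs with
    | @not L₁ L₂ i b =>
      have hf : ((i, !b) : Fin m × Bool) = flip (i, b) := rfl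
      have hg := geo_flip (σ := σ) (walk σ x L₁) (i, b)
      rw [hf, edges_append] at hk
      simp only [edges, List.count_append, List.count_cons, hg, step_flip_step] at hk
      rw [edges_append, List.count_append]
      by_cases he : geo σ (walk σ x L₁) (i, b) = e
      · exact ⟨k + 1, by simp [he] at hk; omega⟩
      · exact ⟨k, by simp [he] at hk; omega⟩

theorem mem_edges {x : X} {w : List (Fin m × Bool)} {e : X × Fin m} (h : e ∈ edges σ x w) :
    ∃ w₁ s w₂, w = w₁ ++ s :: w₂ ∧ e = geo σ (walk σ x w₁) s := by
  induction w generalizing x with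
  | nil => simp [edges] at h
  | cons s w ih =>
    rw [edges, List.mem_cons] at h
    rcases h with h | h
    · exact ⟨[], s, w, rfl, h⟩
    · obtain ⟨w₁, t, w₂, h1, h2⟩ := ih h
      exact ⟨s :: w₁, t, w₂, by simp [h1], h2⟩

theorem not_mem_edges_of_along {x : X} {w : List (Fin m × Bool)} {e : X × Fin m}
    (h : Along σ (fun p s => geo σ p s ≠ e) x w) : e ∉ edges σ x w := by
  induction w generalizing x with
  | nil => simp [edges]
  | cons s w ih =>
    rw [edges, List.mem_cons, not_or]
    exact ⟨h.1.symm, ih h.2⟩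

theorem Along.invRev {r r' : X → Fin m × Bool → Prop} {x : X} {w : List (Fin m × Bool)}
    {p : X → Prop} (hx : p x) (h : Along σ r x w) (hp : ∀ y s, p y → r y s → p (step σ s y))
    (hr : ∀ y s, p y → r y s → r' (step σ s y) (flip s)) :
    Along σ r' (walk σ x w) (FreeGroup.invRev w) := by
  induction w generalizing x with
  | nil => trivial
  | cons s w ih =>
    rw [invRev_cons']
    refine Along.append (ih (hp _ _ hx h.1) h.2) ?_
    rw [walk_cons, walk_invRev]
    exact ⟨hr _ _ hx h.1, trivial⟩

/-! ### Words of bounded length -/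

/-- There is a walk of length at most `r` between two vertices. -/
def Near (σ : Fin m → Equiv.Perm X) (r : ℕ) (x y : X) : Prop :=
  ∃ w : List (Fin m × Bool), w.length ≤ r ∧ walk σ x w = y

theorem Near.symm {r : ℕ} {x y : X} (h : Near σ r x y) : Near σ r y x := by
  obtain ⟨w, hw, rfl⟩ := h
  exact ⟨FreeGroup.invRev w, by rwa [FreeGroup.invRev_length], walk_invRev σ x w⟩

theorem Near.trans {r r' : ℕ} {x y z : X} (h : Near σ r x y) (h' : Near σ r' y z) :
    Near σ (r + r') x z := by
  obtain ⟨w, hw, rfl⟩ := h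
  obtain ⟨w', hw', rfl⟩ := h'
  exact ⟨w ++ w', by rw [List.length_append]; omega, walk_append σ x w w'⟩

theorem Near.mono {r r' : ℕ} {x y : X} (h : Near σ r x y) (hr : r ≤ r') : Near σ r' x y := by
  obtain ⟨w, hw, h⟩ := h
  exact ⟨w, hw.trans hr, h⟩

theorem near_refl (x : X) (r : ℕ) : Near σ r x x := ⟨[], Nat.zero_le _, rfl⟩

theorem near_step (x : X) (s : Fin m × Bool) : Near σ 1 x (step σ s x) := ⟨[s], le_rfl, rfl⟩

variable (m) in
/-- The words of bounded length. -/
noncomputable def wordsLE (r : ℕ) : Finset (List (Fin m × Bool)) :=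
  (List.finite_length_le (Fin m × Bool) r).toFinset

theorem mem_wordsLE {r : ℕ} {w : List (Fin m × Bool)} : w ∈ wordsLE m r ↔ w.length ≤ r := by
  simp [wordsLE]

/-- A point of `A` is determined by a nearby element of `B`, a short word leading from it, and the
coordinate `κ`. In fibre products, `f` and `κ` are the two projections. -/
theorem card_le_of_near {Ω Ω' Y : Type*} {A : Finset Ω} {B : Finset Ω'} {C : Finset Y} {r : ℕ}
    {g : Ω' → X} {f : Ω → X} {κ : Ω → Y} (hκ : ∀ p ∈ A, κ p ∈ C)
    (hinj : ∀ p ∈ A, ∀ q ∈ A, κ p = κ q → f p = f q → p = q)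
    (h : ∀ p ∈ A, ∃ b ∈ B, Near σ r (g b) (f p)) : #A ≤ #B * (#C * #(wordsLE m r)) := by
  rcases A.eq_empty_or_nonempty with rfl | ⟨a, ha⟩
  · simp
  have : Nonempty Ω' := ⟨(h a ha).choose⟩
  choose! b hb w hw hbw using h
  rw [← card_product, ← card_product]
  refine card_le_card_of_injOn (fun p => (b p, κ p, w p)) ?_ ?_
  · intro p hp
    simp only [coe_product, Set.mem_prod, mem_coe]
    exact ⟨hb p hp, hκ p hp, mem_wordsLE.2 (hw p hp)⟩
  · intro p hp q hq hpq
    simp only [Prod.mk.injEq] at hpq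
    refine hinj p hp q hq hpq.2.1 ?_
    rw [← hbw p hp, ← hbw q hq, hpq.1, hpq.2.2]

/-- Greedy choice: apart from the bad points, each point already chosen forbids at most `c` others.
-/
theorem exists_far {Ω : Type*} {A bad : Finset Ω} {N : Ω → Ω → Prop}
    (hN : ∀ p q, N p q → N q p) {c : ℕ} (hc : ∀ p ∈ A, #{q ∈ A | N p q} ≤ c) (k : ℕ)
    (hk : #bad + k * c < #A) :
    ∃ q : Fin (k + 1) → Ω, (∀ i, q i ∈ A ∧ q i ∉ bad) ∧ ∀ i j, i ≠ j → ¬ N (q i) (q j) := by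
  induction k with
  | zero =>
    obtain ⟨a, ha, hab⟩ := exists_mem_notMem_of_card_lt_card (s := bad) (t := A) (by omega)
    exact ⟨fun _ => a, fun _ => ⟨ha, hab⟩, fun i j hij => absurd (Subsingleton.elim (α := Fin 1) i j) hij⟩
  | succ k ih =>
    obtain ⟨q, hq, hqN⟩ := ih (by nlinarith)
    obtain ⟨a, ha, hab⟩ := exists_mem_notMem_of_card_lt_card
      (s := bad ∪ univ.biUnion fun i => {x ∈ A | N (q i) x}) (t := A) (by
        refine lt_of_le_of_lt ((card_union_le _ _).trans (Nat.add_le_add_left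
          (card_biUnion_le.trans (sum_le_card_nsmul _ _ c fun i _ => hc _ (hq i).1)) _)) ?_
        simpa using hk)
    simp only [mem_union, mem_biUnion, mem_univ, true_and, mem_filter, not_or, not_exists,
      not_and] at hab
    refine ⟨Fin.cons a q, fun i => ?_, fun i j hij => ?_⟩
    · refine Fin.cases ⟨ha, hab.1⟩ (fun i => ?_) i
      simpa using hq i
    · induction i using Fin.cases with
      | zero =>
        induction j using Fin.cases with
        | zero => exact absurd rfl hij
        | succ j => simpa using fun h => hab.2 j ha (hN _ _ h)
      | succ i =>
        induction j using Fin.cases with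
        | zero => simpa using hab.2 i ha
        | succ j => simpa using hqN i j (fun h => hij (by rw [h]))

/-- Breadth-first search: the sets of points reached in at most `n` steps stay inside `T` and grow
strictly until they are closed under allowed steps. -/
theorem exists_short_walk {r : X → Fin m × Bool → Prop} {T : Finset X} {u : X} (hu : u ∈ T)
    (hT : ∀ p ∈ T, ∀ s, r p s → step σ s p ∈ T) {w : List (Fin m × Bool)} (hw : Along σ r u w) :
    ∃ w', w'.length ≤ #T ∧ walk σ u w' = walk σ u w := by
  let S : ℕ → Finset X := fun n => {p ∈ T | ∃ w', w'.length ≤ n ∧ Along σ r u w' ∧ walk σ u w' = p}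
  have hS : ∀ n, S n ⊆ S (n + 1) := by
    intro n p
    simp only [S, mem_filter]
    rintro ⟨h, w', h1, h2⟩
    exact ⟨h, w', by omega, h2⟩
  have hstep : ∀ n, ∀ p ∈ S n, ∀ s, r p s → step σ s p ∈ S (n + 1) := by
    intro n p hp s hs
    simp only [S, mem_filter] at hp ⊢
    obtain ⟨h, w', h1, h2, h3⟩ := hp
    refine ⟨hT p h s hs, w' ++ [s], by simpa using h1, h2.append ?_, ?_⟩
    · rw [h3]; exact ⟨hs, trivial⟩
    · rw [walk_append, h3]; rfl
  have hu0 : u ∈ S 0 := mem_filter.2 ⟨hu, [], le_rfl, trivial, rfl⟩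
  have key : ∀ n, walk σ u w ∈ S n ∨ n + 1 ≤ #(S n) := by
    intro n
    induction n with
    | zero => exact Or.inr (card_pos.2 ⟨u, hu0⟩)
    | succ n ih =>
      rcases ih with ih | ih
      · exact Or.inl (hS n ih)
      · by_cases he : S (n + 1) = S n
        · left
          have hcl : ∀ (w : List (Fin m × Bool)) x, x ∈ S n → Along σ r x w → walk σ x w ∈ S n := by
            intro w
            induction w with
            | nil => intro x hx _; exact hx
            | cons s w ihw =>
              intro x hx h
              exact ihw _ (he ▸ hstep n x hx s h.1) h.2
          have hu' : u ∈ S n := monotone_nat_of_le_succ hS (Nat.zero_le n) hu0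
          exact hS n (hcl w u hu' hw)
        · right
          have := card_lt_card (Finset.ssubset_iff_subset_ne.2 ⟨hS n, Ne.symm he⟩)
          omega
  rcases key #T with h | h
  · obtain ⟨_, w', h1, _, h2⟩ := mem_filter.1 h
    exact ⟨w', h1, h2⟩
  · have : #(S #T) ≤ #T := card_le_card (filter_subset _ _)
    omega

/-! ### Boundaries -/

variable (σ)

/-- The number of directed edges of `P` that leave `A`. -/
noncomputable def bd (P A : Finset X) : ℕ :=
  ∑ p ∈ A, #{s : Fin m × Bool | step σ s p ∈ P ∧ step σ s p ∉ A}

variable {σ}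

theorem sum_deg_eq {P A : Finset X} (hA : A ⊆ P) :
    ∑ p ∈ A, deg σ P p = totalDeg σ A + bd σ P A := by
  rw [totalDeg, bd, ← sum_add_distrib]
  refine sum_congr rfl fun p _ => ?_
  rw [deg, ← card_filter_add_card_filter_not (fun s => step σ s p ∈ A), filter_filter,
    filter_filter, deg]
  congr 2
  refine filter_congr fun s _ => ?_
  exact ⟨fun h => h.2, fun h => ⟨hA h, h⟩⟩

theorem card_le_bd {P A B : Finset X}
    (hB : ∀ p ∈ B, p ∈ A ∧ ∃ s, step σ s p ∈ P ∧ step σ s p ∉ A) : #B ≤ bd σ P A := by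
  rw [card_eq_sum_ones, bd]
  refine le_trans (sum_le_sum fun p hp => ?_) (sum_le_sum_of_subset fun p hp => (hB p hp).1)
  obtain ⟨-, s, hs⟩ := hB p hp
  exact card_pos.2 ⟨s, by simpa using hs⟩

/-- Comparing degree sums, `A` has at most `bd σ P A` branch vertices, those of degree at least
three. A walk of length at most `q` from a vertex of `A` to a branch vertex either stays in `A` or
leaves it through a boundary vertex, so every vertex of `A` is near one of these few vertices. -/
theorem card_le_of_forest {P A : Finset X} (hA : A ⊆ P) (hdeg : ∀ p ∈ P, 2 ≤ deg σ P p) {q : ℕ}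
    (hq : ∀ p ∈ P, ∃ w, w.length ≤ q ∧ Along σ (fun p s => step σ s p ∈ P) p w ∧
      3 ≤ deg σ P (walk σ p w)) (hf : totalDeg σ A ≤ 2 * #A) :
    #A ≤ #(wordsLE m q) * (2 * bd σ P A) := by
  let Br : Finset X := {p ∈ A | 3 ≤ deg σ P p}
  let Bv : Finset X := {p ∈ A | ∃ s, step σ s p ∈ P ∧ step σ s p ∉ A}
  have h1 : #Bv ≤ bd σ P A := card_le_bd fun p hp => mem_filter.1 hp
  have h2 : 2 * #A + #Br ≤ totalDeg σ A + bd σ P A := by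
    rw [← sum_deg_eq hA, card_filter, mul_comm, ← smul_eq_mul, ← sum_const, ← sum_add_distrib]
    refine sum_le_sum fun p hp => ?_
    have := hdeg p (hA hp)
    split_ifs <;> omega
  have h3 : ∀ (w : List (Fin m × Bool)) (p : X), p ∈ A →
      Along σ (fun p s => step σ s p ∈ P) p w → 3 ≤ deg σ P (walk σ p w) →
      ∃ b ∈ Br ∪ Bv, Near σ w.length b p := by
    intro w
    induction w with
    | nil => exact fun p hp _ h => ⟨p, mem_union_left _ (mem_filter.2 ⟨hp, h⟩), near_refl _ _⟩
    | cons s w ih =>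
      intro p hp h h'
      by_cases hs : step σ s p ∈ A
      · obtain ⟨b, hb, hbn⟩ := ih _ hs h.2 h'
        refine ⟨b, hb, ?_⟩
        simpa using hbn.trans (near_step p s).symm
      · exact ⟨p, mem_union_right _ (mem_filter.2 ⟨hp, s, h.1, hs⟩), near_refl _ _⟩
  have h4 := card_le_of_near (σ := σ) (A := A) (B := Br ∪ Bv) (C := {()}) (r := q) (g := id)
    (f := id) (κ := fun _ => ()) (by simp) (fun p _ q _ _ h => h) (by
      intro p hp
      obtain ⟨w, hw, hw1, hw2⟩ := hq p (hA hp)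
      obtain ⟨b, hb, hbn⟩ := h3 w p hp hw1 hw2
      exact ⟨b, hb, hbn.mono hw⟩)
  have h5 := card_union_le Br Bv
  rw [card_singleton, one_mul, mul_comm] at h4
  refine h4.trans (Nat.mul_le_mul_left _ ?_)
  omega

end Edges

/-! ### Loops with private edges in a finite cover of a core -/

section Loops

open scoped Classical
open Finset

variable {m : ℕ} {X Y : Type*} {τ : Fin m → Equiv.Perm Y} {σ : Fin m → Equiv.Perm X}

theorem deg_congr {ρ : Fin m → Equiv.Perm Y} {S : Finset X} {T : Finset Y} {p : X} {c : Y}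
    (h : ∀ s, step σ s p ∈ S ↔ step ρ s c ∈ T) : deg σ S p = deg ρ T c :=
  congrArg card (filter_congr fun s _ => h s)

theorem bd_self (P : Finset X) : bd σ P P = 0 :=
  sum_eq_zero fun _ _ => card_eq_zero.2 (filter_eq_empty_iff.2 fun _ _ h => h.2 h.1)

theorem bd_le_one {P T : Finset X} (v : X) (s₀ : Fin m × Bool)
    (h : ∀ p ∈ T, ∀ s, step σ s p ∈ P → step σ s p ∉ T → p = v ∧ s = s₀) : bd σ P T ≤ 1 := by
  rw [bd, ← card_sigma]
  refine card_le_one.2 ?_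
  have key : ∀ z ∈ T.sigma (fun p => ({s : Fin m × Bool | step σ s p ∈ P ∧ step σ s p ∉ T} :
      Finset (Fin m × Bool))), z = ⟨v, s₀⟩ := by
    rintro ⟨p, s⟩ hz
    simp only [mem_sigma, mem_filter, mem_univ, true_and] at hz
    obtain ⟨rfl, rfl⟩ := h p hz.1 s hz.2.1 hz.2.2
    rfl
  exact fun a ha b hb => (key a ha).trans (key b hb).symm

/-- An edge leaving `T` or `T'` either leaves `A` or is cut, and disjointness ensures that none is
charged twice. -/
theorem bd_add_bd_le {P T T' A : Finset X} {cut : X → Fin m × Bool → Prop} (hT : T ⊆ A)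
    (hT' : T' ⊆ A) (hd : Disjoint T T')
    (h : ∀ p ∈ T, ∀ s, step σ s p ∈ A → ¬ cut p s → step σ s p ∈ T)
    (h' : ∀ p ∈ T', ∀ s, step σ s p ∈ A → ¬ cut p s → step σ s p ∈ T') :
    bd σ P T + bd σ P T' ≤ bd σ P A + ∑ p ∈ A, #{s : Fin m × Bool | cut p s} := by
  have key : ∀ T : Finset X, (∀ p ∈ T, ∀ s, step σ s p ∈ A → ¬ cut p s → step σ s p ∈ T) →
      bd σ P T ≤ ∑ p ∈ T, (#{s : Fin m × Bool | step σ s p ∈ P ∧ step σ s p ∉ A} +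
        #{s : Fin m × Bool | cut p s}) := by
    intro T hT
    refine sum_le_sum fun p hp => le_trans (card_le_card ?_) (card_union_le _ _)
    intro s hs
    simp only [mem_filter, mem_univ, true_and, mem_union] at hs ⊢
    by_contra hc
    push Not at hc
    exact hs.2 (hT p hp s (hc.1 hs.1) hc.2)
  refine (Nat.add_le_add (key T h) (key T' h')).trans ?_
  rw [← sum_union hd]
  refine (sum_le_sum_of_subset (union_subset hT hT')).trans ?_
  rw [sum_add_distrib, bd]

variable (τ σ) in
/-- The diagonal action on a product. -/
def prodPerm (i : Fin m) : Equiv.Perm (Y × X) := Equiv.prodCongr (τ i) (σ i)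

theorem step_prodPerm (s : Fin m × Bool) (p : Y × X) :
    step (prodPerm τ σ) s p = (step τ s p.1, step σ s p.2) := by
  rcases s with ⟨i, b⟩
  cases b <;> rfl

theorem walk_prodPerm (p : Y × X) (w : List (Fin m × Bool)) :
    walk (prodPerm τ σ) p w = (walk τ p.1 w, walk σ p.2 w) := by
  induction w generalizing p with
  | nil => rfl
  | cons s w ih => simp [ih, step_prodPerm]

theorem Girth.prodPerm {R : ℕ} (h : Girth σ R) : Girth (prodPerm τ σ) R := by
  intro w hw h0 hl p hp
  rw [walk_prodPerm] at hp
  exact h w hw h0 hl p.2 (congrArg Prod.snd hp)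

theorem Along.of_prodPerm {r : X → Fin m × Bool → Prop} {p : Y × X} {w : List (Fin m × Bool)}
    (h : Along (prodPerm τ σ) (fun p s => r p.2 s) p w) : Along σ r p.2 w := by
  induction w generalizing p with
  | nil => trivial
  | cons s w ih =>
    refine ⟨h.1, ?_⟩
    have := ih h.2
    rwa [step_prodPerm] at this

theorem Along.to_prodPerm {C : Finset Y} {P : Finset (Y × X)}
    (hP : ∀ p ∈ P, ∀ s, step τ s p.1 ∈ C → step (prodPerm τ σ) s p ∈ P) {p : Y × X} (hp : p ∈ P)
    {w : List (Fin m × Bool)} (h : Along τ (fun c s => step τ s c ∈ C) p.1 w) :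
    Along (RandomTree.prodPerm τ σ) (fun p s => step (RandomTree.prodPerm τ σ) s p ∈ P) p w := by
  induction w generalizing p with
  | nil => trivial
  | cons s w ih =>
    refine ⟨hP p hp s h.1, ih (hP p hp s h.1) ?_⟩
    rw [step_prodPerm]
    exact h.2

/-- In a set with many vertices and with a small boundary there are many loops from the same vertex
such that each of them has an edge of its own. -/
theorem exists_loops_of_minimal {C : Finset Y} {P A : Finset (Y × X)} {K M L r B R : ℕ}
    (hPC : ∀ p ∈ P, p.1 ∈ C) (hdeg : ∀ p ∈ P, 2 ≤ deg (prodPerm τ σ) P p)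
    (hG : Girth σ R) (hM : M + 1 ≤ R) (hrM : M + 2 ≤ r) (hrL : L + 1 ≤ r)
    (hB : 2 * #C * K ≤ B) (hAP : A ⊆ P) (hA : bd (prodPerm τ σ) P A ≤ B)
    (hcard : (B + K) * (#C * #(wordsLE m r)) < #A)
    (hmin : ∀ T ⊆ P, M ≤ #T → bd (prodPerm τ σ) P T ≤ B → #A ≤ #T) :
    ∃ p₀ ∈ P, ∃ (W : Fin K → List (Fin m × Bool)) (e : Fin K → X × Fin m),
      (∀ k, walk (prodPerm τ σ) p₀ (W k) = p₀) ∧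
      (∀ k z, z.length ≤ L → e k ∉ edges σ p₀.2 z) ∧
      ∀ j k, (edges σ p₀.2 (W j)).count (e k) = if j = k then 1 else 0 := by
  set ρ := prodPerm τ σ with hρ
  have hGρ : Girth ρ R := hG.prodPerm
  let Bv : Finset (Y × X) := {p ∈ A | ∃ s, step ρ s p ∈ P ∧ step ρ s p ∉ A}
  have hBv : #Bv ≤ B := (card_le_bd fun p hp => mem_filter.1 hp).trans hA
  -- Distances are measured after projection to `X`, because the edges to be cut are edges of `X`.
  let bad : Finset (Y × X) := {p ∈ A | ∃ b ∈ Bv, Near σ r b.2 p.2}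
  have hbad : #bad ≤ B * (#C * #(wordsLE m r)) := by
    refine (card_le_of_near (σ := σ) (B := Bv) (C := C) (g := Prod.snd) (f := Prod.snd)
      (κ := Prod.fst) (fun p hp => hPC p (hAP (mem_filter.1 hp).1))
      (fun p _ q _ h1 h2 => Prod.ext h1 h2) fun p hp => (mem_filter.1 hp).2).trans
      (Nat.mul_le_mul_right _ hBv)
  -- The vertex `x 0` is the base point of all loops; the private edges are taken at the `K` other
  -- vertices.
  obtain ⟨x, hx, hfar⟩ := exists_far (A := A) (bad := bad)
    (N := fun p q => Near σ r p.2 q.2) (fun p q h => h.symm) (c := #C * #(wordsLE m r))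
    (by
      intro p _
      have := card_le_of_near (σ := σ) (r := r) (A := {q ∈ A | Near σ r p.2 q.2}) (B := {p}) (C := C)
        (g := Prod.snd) (f := Prod.snd)
        (κ := Prod.fst) (fun p hp => hPC p (hAP (mem_filter.1 hp).1))
        (fun p _ q _ h1 h2 => Prod.ext h1 h2)
        fun q hq => ⟨p, mem_singleton_self p, (mem_filter.1 hq).2⟩
      simpa using this) K (by rw [add_mul] at hcard; omega)
  have hNB : ∀ i, ∀ p ∈ A, Near σ r (x i).2 p.2 → ∀ s, step ρ s p ∈ P → step ρ s p ∈ A := by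
    intro i p hp hn s hs
    by_contra hc
    exact (hx i).2 (mem_filter.2 ⟨(hx i).1, p, mem_filter.2 ⟨hp, s, hs, hc⟩, hn.symm⟩)
  have ht : ∀ i, ∃ t, step ρ t (x i) ∈ P := by
    intro i
    obtain ⟨t, ht⟩ := card_pos.1 (lt_of_lt_of_le two_pos (hdeg _ (hAP (hx i).1)))
    exact ⟨t, by simpa using ht⟩
  choose t ht using ht
  let e : Fin K → X × Fin m := fun k => geo σ (x k.succ).2 (t k.succ)
  -- All lifts of each `e k` are cut, since the projected loop must not meet `e k` through another
  -- lift.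
  let cut : Y × X → Fin m × Bool → Prop := fun p s => ∃ k, e k = geo σ p.2 s
  let rel : Y × X → Fin m × Bool → Prop := fun p s => step ρ s p ∈ A ∧ ¬ cut p s
  let comp : Y × X → Finset (Y × X) := fun v => {p ∈ A | ∃ w, Along ρ rel v w ∧ walk ρ v w = p}
  have hcompA : ∀ v, comp v ⊆ A := fun v => filter_subset _ _
  have hself : ∀ v ∈ A, v ∈ comp v := fun v hv => mem_filter.2 ⟨hv, [], trivial, rfl⟩
  have hcomp : ∀ v, ∀ p ∈ comp v, ∀ s, rel p s → step ρ s p ∈ comp v := by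
    intro v p hp s hs
    obtain ⟨_, w, hw, hwp⟩ := mem_filter.1 hp
    refine mem_filter.2 ⟨hs.1, w ++ [s], hw.append ?_, ?_⟩
    · rw [hwp]; exact ⟨hs, trivial⟩
    · rw [walk_append, hwp]; rfl
  have hcutnear : ∀ (p : Y × X) (s : Fin m × Bool) (k : Fin K), e k = geo σ p.2 s → Near σ 1 p.2 (x k.succ).2 := by
    intro p s k h
    rcases geo_eq_geo h with ⟨h, -⟩ | ⟨h, -⟩
    · rw [h]; exact near_refl _ _
    · rw [h]; exact (near_step _ _).symm
  -- components of the distinguished vertices are large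
  have hbig : ∀ v ∈ A, ∀ i, Near σ 1 (x i).2 v.2 → ∀ s₀ : Fin m × Bool,
      (∀ k : Fin K, i = k.succ → e k = geo σ v.2 s₀) → M ≤ #(comp v) := by
    intro v hv i hiv s₀ hs₀
    by_contra hlt
    -- A component with fewer than `M` vertices spans a forest, and all degrees in `P` are at least
    -- two, so at least two directed edges leave it. Separation and girth will show that the only
    -- possible exit is `s₀` at `v`.
    have h1 := hGρ.totalDeg_lt ⟨v, hself v hv⟩ (by omega)
    have h2 := sum_deg_eq (σ := ρ) ((hcompA v).trans hAP)
    have h3 : 2 * #(comp v) ≤ ∑ p ∈ comp v, deg ρ P p := by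
      rw [mul_comm, ← smul_eq_mul, ← sum_const]
      exact sum_le_sum fun p hp => hdeg p (hAP (hcompA v hp))
    have h4 : 2 ≤ bd ρ P (comp v) := by omega
    suffices h5 : ∀ p ∈ comp v, ∀ s, step ρ s p ∈ P → step ρ s p ∉ comp v → p = v ∧ s = s₀ by
      have := bd_le_one v s₀ h5
      omega
    intro p hp s hsP hsc
    obtain ⟨_, w', hw', hwp'⟩ := mem_filter.1 hp
    obtain ⟨w, hw, hwp⟩ := exists_short_walk (hself v hv) (hcomp v) hw'
    rw [hwp'] at hwp
    have hwp2 : walk σ v.2 w = p.2 := by rw [← hwp, hρ, walk_prodPerm]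
    have hvp : Near σ M v.2 p.2 := ⟨w, by omega, hwp2⟩
    have hip : Near σ (1 + M) (x i).2 p.2 := hiv.trans hvp
    have hsA := hNB i p (hcompA v hp) (hip.mono (by omega)) s hsP
    have hcut : cut p s := by
      by_contra hc
      exact hsc (hcomp v p hp s ⟨hsA, hc⟩)
    obtain ⟨k, hk⟩ := hcut
    have hik : i = k.succ := by
      by_contra hne
      exact hfar _ _ hne ((hip.trans (hcutnear p s k hk)).mono (by omega))
    rw [hs₀ k hik] at hk
    -- By girth, a short walk that closes up in `X` closes up in the product. If the exit starts at
    -- the projection of `v`, then `p = v`; if it crosses the edge backwards, it ends at `v` and is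
    -- no exit.
    rcases geo_eq_geo hk with ⟨h6, rfl⟩ | ⟨h6, rfl⟩
    · have h7 := hG.mk_eq_one (w := w) (by omega) (hwp2.trans h6)
      have h8 : walk ρ v w = v := walk_congr ρ (w' := []) (by rw [h7]; rfl) v
      exact ⟨hwp.symm.trans h8, rfl⟩
    · exfalso
      have h7 := hG.mk_eq_one (w := w ++ [flip s₀]) (by simp; omega) (x := v.2)
        (by rw [walk_append, hwp2, h6]; simp)
      have h8 : walk ρ v (w ++ [flip s₀]) = v := walk_congr ρ (w' := []) (by rw [h7]; rfl) v
      rw [walk_append, hwp] at h8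
      simp only [walk_cons, walk_nil] at h8
      rw [h8] at hsc
      exact hsc (hself v hv)
  have hrelflip : ∀ y s, y ∈ A → rel y s → rel (step ρ s y) (flip s) := by
    intro y s hy hs
    refine ⟨by simpa using hy, ?_⟩
    rintro ⟨k, hk⟩
    rw [hρ, step_prodPerm, geo_flip] at hk
    exact hs.2 ⟨k, hk⟩
  -- A cut directed edge is determined by its coordinate in `C`, an index `k` with projection `e k`,
  -- and its direction.
  have hcutcard : ∑ p ∈ A, #{s : Fin m × Bool | cut p s} ≤ B := by
    refine le_trans ?_ hB
    rw [← card_sigma]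
    have : 2 * #C * K = #(C ×ˢ (univ : Finset (Fin K)) ×ˢ (univ : Finset Bool)) := by
      simp; ring
    rw [this]
    have hch : ∀ z : (_ : Y × X) × (Fin m × Bool), ∃ k : Option (Fin K),
        cut z.1 z.2 → ∃ k', k = some k' ∧ e k' = geo σ z.1.2 z.2 := by
      intro z
      by_cases h : cut z.1 z.2
      · obtain ⟨k, hk⟩ := h
        exact ⟨some k, fun _ => ⟨k, rfl, hk⟩⟩
      · exact ⟨none, fun h' => absurd h' h⟩
    choose κ hκ using hch
    rw [← card_image_of_injective (C ×ˢ (univ : Finset (Fin K)) ×ˢ (univ : Finset Bool))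
      (f := fun a => (a.1, some a.2.1, a.2.2)) (by
        rintro ⟨a, b, c⟩ ⟨a', b', c'⟩ h; simpa using h)]
    refine card_le_card_of_injOn (fun z => (z.1.1, κ z, z.2.2)) ?_ ?_
    · rintro ⟨p, s⟩ hz
      simp only [coe_sigma, Set.mem_sigma_iff, mem_coe, mem_filter, mem_univ, true_and] at hz
      obtain ⟨k', hk', -⟩ := hκ ⟨p, s⟩ hz.2
      simp only [coe_image, Set.mem_image, mem_coe, mem_product, mem_univ, and_true]
      exact ⟨(p.1, k', s.2), hPC p (hAP hz.1), by simp [hk']⟩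
    · rintro ⟨p, s⟩ hz ⟨p', s'⟩ hz' heq
      simp only [coe_sigma, Set.mem_sigma_iff, mem_coe, mem_filter, mem_univ, true_and] at hz hz'
      obtain ⟨k, hk, hke⟩ := hκ ⟨p, s⟩ hz.2
      obtain ⟨k', hk', hke'⟩ := hκ ⟨p', s'⟩ hz'.2
      simp only [Prod.mk.injEq] at heq
      obtain ⟨h1, h2, h3⟩ := heq
      rw [hk, hk', Option.some.injEq] at h2
      rw [h2, hke'] at hke
      rcases geo_eq_geo hke with ⟨h4, h5⟩ | ⟨-, h5⟩
      · have : p = p' := Prod.ext h1 h4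
        simp only at h5
        rw [this, h5]
      · exfalso
        change s = flip s' at h5
        rw [h5] at h3
        simp [flip] at h3
  -- Two disjoint large components have boundaries of total size at most `2 * B`, so one of them has
  -- boundary at most `B`. By minimality it is all of `A`, which leaves no room for the other.
  have hunique : ∀ v ∈ A, ∀ v' ∈ A, M ≤ #(comp v) → M ≤ #(comp v') → v' ∈ comp v := by
    intro v hv v' hv' hMv hMv'
    by_contra hnot
    have hdisj : Disjoint (comp v) (comp v') := by
      rw [disjoint_left]
      intro p hp hp'
      obtain ⟨_, w, hw, hwp⟩ := mem_filter.1 hp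
      obtain ⟨_, w', hw', hwp'⟩ := mem_filter.1 hp'
      apply hnot
      have h1 := hw'.invRev (r' := rel) (p := (· ∈ A)) hv' (fun y s _ h => h.1) hrelflip
      refine mem_filter.2 ⟨hv', w ++ FreeGroup.invRev w', hw.append ?_, ?_⟩
      · rw [hwp, ← hwp']; exact h1
      · rw [walk_append, hwp, ← hwp', walk_invRev]
    have htot : bd ρ P (comp v) + bd ρ P (comp v') ≤ B + B :=
      (bd_add_bd_le (cut := cut) (hcompA v) (hcompA v') hdisj
        (fun p hp s h1 h2 => hcomp v p hp s ⟨h1, h2⟩)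
        (fun p hp s h1 h2 => hcomp v' p hp s ⟨h1, h2⟩)).trans (Nat.add_le_add hA (by convert hcutcard))
    rcases le_or_gt (bd ρ P (comp v)) B with h | h
    · have h1 := hmin _ ((hcompA v).trans hAP) hMv h
      rw [eq_of_subset_of_card_le (hcompA v) h1] at hnot
      exact hnot hv'
    · have h1 := hmin _ ((hcompA v').trans hAP) hMv' (by omega)
      have h2 := eq_of_subset_of_card_le (hcompA v') h1
      exact disjoint_left.1 hdisj (hself v hv) (by rw [h2]; exact hv)
  have hb0 := hbig (x 0) (hx 0).1 0 (near_refl _ _) (t 0)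
    (fun k hk => absurd hk.symm (Fin.succ_ne_zero k))
  have hb1 : ∀ k : Fin K, M ≤ #(comp (x k.succ)) := fun k =>
    hbig _ (hx _).1 k.succ (near_refl _ _) (t k.succ) (fun j hj => by
      rw [Fin.succ_inj.1 hj])
  have hmem2 : ∀ k : Fin K, step ρ (t k.succ) (x k.succ) ∈ A := fun k =>
    hNB k.succ _ (hx _).1 (near_refl _ _) _ (ht _)
  have hb2 : ∀ k : Fin K, M ≤ #(comp (step ρ (t k.succ) (x k.succ))) := fun k =>
    hbig _ (hmem2 k) k.succ (by rw [hρ, step_prodPerm]; exact near_step _ _) (flip (t k.succ))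
      (fun j hj => by rw [hρ, step_prodPerm, geo_flip, Fin.succ_inj.1 hj])
  have hpa : ∀ k : Fin K, ∃ w, Along ρ rel (x 0) w ∧ walk ρ (x 0) w = x k.succ := fun k =>
    (mem_filter.1 (hunique _ (hx 0).1 _ (hx k.succ).1 hb0 (hb1 k))).2
  have hpb : ∀ k : Fin K, ∃ w, Along ρ rel (step ρ (t k.succ) (x k.succ)) w ∧
      walk ρ (step ρ (t k.succ) (x k.succ)) w = x 0 := fun k =>
    (mem_filter.1 (hunique _ (hmem2 k) _ (hx 0).1 (hb2 k) hb0)).2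
  choose a ha hax using hpa
  choose b hb hbx using hpb
  have hinj : ∀ j k : Fin K, e j = e k → j = k := by
    intro j k h
    by_contra hne
    refine hfar j.succ k.succ (fun h' => hne (Fin.succ_inj.1 h')) ?_
    exact (hcutnear _ _ j h).symm.mono (by omega)
  -- Only the middle letter crosses a cut edge. Walks of length at most `L` from the base point miss
  -- the edges `e k` because these start at distance more than `r ≥ L + 1`.
  refine ⟨x 0, hAP (hx 0).1, fun k => a k ++ t k.succ :: b k, e, ?_, ?_, ?_⟩
  · intro k
    rw [walk_append, hax, walk_cons, hbx]
  · intro k z hz hmem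
    obtain ⟨w₁, s, w₂, rfl, h⟩ := mem_edges hmem
    have h1 : Near σ L (x 0).2 (walk σ (x 0).2 w₁) := ⟨w₁, by simp at hz; omega, rfl⟩
    have h2 := hcutnear ((x 0).1, walk σ (x 0).2 w₁) s k h
    exact hfar 0 k.succ (Fin.succ_ne_zero k).symm ((h1.trans h2).mono (by omega))
  · intro j k
    have hza : e k ∉ edges σ (x 0).2 (a j) := by
      refine not_mem_edges_of_along (Along.of_prodPerm (τ := τ) ((ha j).mono ?_))
      exact fun p s h h' => h.2 ⟨k, h'.symm⟩
    have hzb : e k ∉ edges σ (step ρ (t j.succ) (x j.succ)).2 (b j) := by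
      refine not_mem_edges_of_along (Along.of_prodPerm (τ := τ) ((hb j).mono ?_))
      exact fun p s h h' => h.2 ⟨k, h'.symm⟩
    have hw : walk σ (x 0).2 (a j) = (x j.succ).2 := by
      have := congrArg Prod.snd (hax j)
      rwa [hρ, walk_prodPerm] at this
    rw [hρ, step_prodPerm] at hzb
    rw [edges_append, hw, List.count_append, List.count_eq_zero.2 hza, edges, List.count_cons,
      List.count_eq_zero.2 hzb]
    change 0 + (0 + if e j == e k then 1 else 0) = _
    by_cases hjk : j = k
    · simp [hjk]
    · simp only [hjk, if_false, beq_iff_eq, zero_add, ite_eq_right_iff, one_ne_zero, imp_false]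
      exact fun h => hjk (hinj j k h)

/-- Above a finite connected graph with negative Euler characteristic, a finite cover which is
immersed into a Schreier graph of large girth contains many loops from the same vertex such that each
of them has an edge of its own. -/
theorem exists_loops {C : Finset Y} (hC : ∀ c ∈ C, 2 ≤ deg τ C c) {c₀ : Y} (h3 : 3 ≤ deg τ C c₀)
    (hconn : ∀ c ∈ C, ∃ w, Along τ (fun p s => step τ s p ∈ C) c w ∧ walk τ c w = c₀) (K L : ℕ) :
    ∃ R : ℕ, ∀ (X : Type) (σ : Fin m → Equiv.Perm X), Girth σ R → ∀ P : Finset (Y × X),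
      P.Nonempty → (∀ p ∈ P, p.1 ∈ C) →
      (∀ p ∈ P, ∀ s, step τ s p.1 ∈ C → step (prodPerm τ σ) s p ∈ P) →
      ∃ p₀ ∈ P, ∃ (W : Fin K → List (Fin m × Bool)) (e : Fin K → X × Fin m),
        (∀ k, walk (prodPerm τ σ) p₀ (W k) = p₀) ∧
        (∀ k z, z.length ≤ L → e k ∉ edges σ p₀.2 z) ∧
        ∀ j k, (edges σ p₀.2 (W j)).count (e k) = if j = k then 1 else 0 := by
  choose! w hw hwc using hconn
  let q : ℕ := C.sup fun c => (w c).length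
  -- `B` bounds the number of directed lifts of `K` edges. A forest in `P` with boundary at most `B`
  -- has fewer than `M` vertices. More than `R` vertices leave room for `K + 1` vertices that are
  -- `r`-far from each other and from a boundary of size at most `B`.
  let B : ℕ := 2 * #C * K
  let M : ℕ := #(wordsLE m q) * (2 * B) + 1
  let r : ℕ := M + L + 2
  let R : ℕ := (B + K) * (#C * #(wordsLE m r)) + M + 1
  refine ⟨R, fun X σ hG P hne hPC hP => ?_⟩
  have hdegP : ∀ p ∈ P, deg (prodPerm τ σ) P p = deg τ C p.1 := by
    intro p hp
    refine deg_congr fun s => ⟨fun h => ?_, fun h => hP p hp s h⟩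
    have := hPC _ h
    rwa [step_prodPerm] at this
  have hdeg : ∀ p ∈ P, 2 ≤ deg (prodPerm τ σ) P p := fun p hp => by
    rw [hdegP p hp]; exact hC _ (hPC p hp)
  have hwalkP : ∀ (w : List (Fin m × Bool)) (p : Y × X), p ∈ P →
      Along (prodPerm τ σ) (fun p s => step (prodPerm τ σ) s p ∈ P) p w →
      walk (prodPerm τ σ) p w ∈ P := by
    intro w
    induction w with
    | nil => exact fun p hp _ => hp
    | cons s w ih => exact fun p hp h => ih _ h.1 h.2
  have hq : ∀ p ∈ P, ∃ w, w.length ≤ q ∧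
      Along (prodPerm τ σ) (fun p s => step (prodPerm τ σ) s p ∈ P) p w ∧
      3 ≤ deg (prodPerm τ σ) P (walk (prodPerm τ σ) p w) := by
    intro p hp
    have h1 := Along.to_prodPerm hP hp (hw p.1 (hPC p hp))
    refine ⟨w p.1, le_sup (f := fun c => (w c).length) (hPC p hp), h1, ?_⟩
    rw [hdegP _ (hwalkP _ p hp h1), walk_prodPerm, hwc _ (hPC p hp)]
    exact h3
  have hGρ : Girth (prodPerm τ σ) R := hG.prodPerm
  -- There are no intermediate sizes: up to `R` vertices the set spans a forest, and then its small
  -- boundary forces fewer than `M` vertices.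
  have hlarge : ∀ T ⊆ P, T.Nonempty → M ≤ #T → bd (prodPerm τ σ) P T ≤ B → R < #T := by
    intro T hT hTne hMT hbT
    by_contra hle
    have h1 := hGρ.totalDeg_lt hTne (by omega)
    have h2 := card_le_of_forest hT hdeg hq (by omega)
    have h4 : #(wordsLE m q) * (2 * bd (prodPerm τ σ) P T) ≤ #(wordsLE m q) * (2 * B) :=
      Nat.mul_le_mul_left _ (by omega)
    omega
  have hbdP : bd (prodPerm τ σ) P P = 0 := bd_self P
  have hMP : M ≤ #P := by
    by_contra hlt
    have h1 := hGρ.totalDeg_lt hne (by omega)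
    have h2 := sum_deg_eq (σ := prodPerm τ σ) (Subset.refl P)
    have h4 : 2 * #P ≤ ∑ p ∈ P, deg (prodPerm τ σ) P p := by
      rw [mul_comm, ← smul_eq_mul, ← sum_const]
      exact sum_le_sum fun p hp => hdeg p hp
    omega
  obtain ⟨A, ⟨hAP, hAM, hAB⟩, hmin⟩ := WellFounded.has_min
    (measure (fun T : Finset (Y × X) => #T)).wf
    {T | T ⊆ P ∧ M ≤ #T ∧ bd (prodPerm τ σ) P T ≤ B} ⟨P, Subset.refl P, hMP, by omega⟩
  have hRA := hlarge A hAP (card_pos.1 (by omega)) hAM hAB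
  refine exists_loops_of_minimal (M := M) (r := r) (B := B) hPC hdeg hG (by omega) (by omega)
    (by omega) le_rfl hAP hAB (by omega) ?_
  intro T hT hMT hbT
  exact not_lt.1 (hmin T ⟨hT, hMT, hbT⟩)

end Loops

/-! ### The fibre product of a level graph with the coset graph of `Δ` -/

section CosetLoops

open Finset

variable {m : ℕ}

/-- The right action of the free group on the cosets of a subgroup. -/
def cosetPerm (Δ : Subgroup (FreeGroup (Fin m))) (i : Fin m) :
    Equiv.Perm (FreeGroup (Fin m) ⧸ Δ) :=
  MulAction.toPerm (FreeGroup.of i)⁻¹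

/-- The quotient consists of the cosets `gΔ`, on which a right action is left multiplication by
inverses. The words that are closed at the trivial coset are then those of elements of `Δ`. -/
theorem walk_cosetPerm (Δ : Subgroup (FreeGroup (Fin m))) (g : FreeGroup (Fin m))
    (w : List (Fin m × Bool)) :
    walk (cosetPerm Δ) (g : FreeGroup (Fin m) ⧸ Δ) w = ((FreeGroup.mk w)⁻¹ * g : FreeGroup (Fin m)) := by
  induction w generalizing g with
  | nil =>
    have h1 : (FreeGroup.mk [] : FreeGroup (Fin m)) = 1 := rfl
    simp [h1]
  | cons s w ih =>
    have h : FreeGroup.mk (s :: w) = FreeGroup.mk [s] * FreeGroup.mk w := by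
      rw [FreeGroup.mul_mk]; rfl
    have h2 : step (cosetPerm Δ) s (g : FreeGroup (Fin m) ⧸ Δ) =
        (((FreeGroup.mk [s])⁻¹ * g : FreeGroup (Fin m)) : FreeGroup (Fin m) ⧸ Δ) := by
      rcases s with ⟨i, b⟩
      cases b
      · have h3 : FreeGroup.mk [(i, false)] = (FreeGroup.of i)⁻¹ := by
          rw [FreeGroup.of, FreeGroup.inv_mk]; rfl
        rw [h3]
        change (MulAction.toPerm (FreeGroup.of i)⁻¹)⁻¹ _ = _
        rw [Equiv.Perm.inv_eq_iff_eq]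
        change _ = (((FreeGroup.of i)⁻¹ * ((FreeGroup.of i)⁻¹⁻¹ * g) : FreeGroup (Fin m)) :
          FreeGroup (Fin m) ⧸ Δ)
        rw [mul_inv_cancel_left]
      · rfl
    rw [walk_cons, h2, ih, h, mul_inv_rev, mul_assoc]

theorem walk_cosetPerm_eq_iff (Δ : Subgroup (FreeGroup (Fin m))) (w : List (Fin m × Bool)) :
    walk (cosetPerm Δ) ((1 : FreeGroup (Fin m)) : FreeGroup (Fin m) ⧸ Δ) w =
      ((1 : FreeGroup (Fin m)) : FreeGroup (Fin m) ⧸ Δ) ↔ FreeGroup.mk w ∈ Δ := by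
  rw [walk_cosetPerm, QuotientGroup.eq]
  simp

/-- In actions of large girth, each orbit of a noncyclic subgroup `Δ` contains a vertex with many
loops labelled by elements of `Δ` such that each of them has an edge of its own. -/
theorem exists_orbit_loops {Δ : Subgroup (FreeGroup (Fin m))} (hΔ : ¬ IsCyclic Δ) (K : ℕ) :
    ∃ R : ℕ, ∀ (X : Type) [Finite X] (σ : Fin m → Equiv.Perm X), Girth σ R → ∀ x₀ : X,
      ∃ (v : X) (α : Fin K → FreeGroup (Fin m)) (e : Fin K → X × Fin m),
        (∃ δ ∈ Δ, walk σ x₀ δ.toWord = v) ∧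
        (∀ k, α k ∈ Δ ∧ walk σ v (α k).toWord = v) ∧
        ∀ j k, (open scoped Classical in (edges σ v (α j).toWord).count (e k)) =
          if j = k then 1 else 0 := by
  classical
  obtain ⟨g, hg, h, hh, hgh⟩ := exists_not_commute hΔ
  set y₀ : FreeGroup (Fin m) ⧸ Δ := ((1 : FreeGroup (Fin m)) : FreeGroup (Fin m) ⧸ Δ) with hy₀
  obtain ⟨S, hS⟩ := exists_two_mul_card_add_two_le (σ := cosetPerm Δ) (y := y₀) (g := g) (h := h)
    (by rw [walk_cosetPerm_eq_iff, FreeGroup.mk_toWord]; exact hg)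
    (by rw [walk_cosetPerm_eq_iff, FreeGroup.mk_toWord]; exact hh) hgh
  obtain ⟨C, hC, c₀, hc₀, h3, hconn⟩ := exists_core hS
  have hz : ∀ c : FreeGroup (Fin m) ⧸ Δ, ∃ z, walk (cosetPerm Δ) y₀ z = c := by
    intro c
    induction c using QuotientGroup.induction_on with
    | H a =>
      refine ⟨a⁻¹.toWord, ?_⟩
      rw [hy₀, walk_cosetPerm, FreeGroup.mk_toWord]
      simp
  choose z hz using hz
  -- The base point of the loops may lie over any coset in `C`. The bound `L` covers the words `z c`
  -- that connect it with the trivial coset.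
  obtain ⟨R, hR⟩ := exists_loops hC h3 hconn K (C.sup fun c => (z c).length)
  refine ⟨R, fun X _ σ hG x₀ => ?_⟩
  have hfin : {p : (FreeGroup (Fin m) ⧸ Δ) × X | p.1 ∈ C ∧
      ∃ w, walk (prodPerm (cosetPerm Δ) σ) (y₀, x₀) w = p}.Finite :=
    ((C.finite_toSet).prod (Set.finite_univ (α := X))).subset fun p hp => ⟨hp.1, trivial⟩
  -- `P` is the part above `C` of the component of `(y₀, x₀)`. Staying in this component keeps the
  -- final vertex in the orbit of `x₀` under `Δ`.
  obtain ⟨p₀, hp₀, W, e, hW, hL, hcount⟩ := hR X σ hG hfin.toFinset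
    ⟨walk (prodPerm (cosetPerm Δ) σ) (y₀, x₀) (z c₀), by
      rw [Set.Finite.mem_toFinset]
      refine ⟨?_, _, rfl⟩
      rw [walk_prodPerm, hz]
      exact hc₀⟩
    (fun p hp => ((Set.Finite.mem_toFinset _).1 hp).1)
    (fun p hp s hs => by
      rw [Set.Finite.mem_toFinset] at hp ⊢
      obtain ⟨hp, w, hw⟩ := hp
      refine ⟨by rw [step_prodPerm]; exact hs, w ++ [s], ?_⟩
      rw [walk_append, hw]
      rfl)
  rw [Set.Finite.mem_toFinset] at hp₀
  obtain ⟨hpC, w₀, hw₀⟩ := hp₀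
  have hw1 : walk (cosetPerm Δ) y₀ w₀ = p₀.1 := by rw [← hw₀, walk_prodPerm]
  have hw2 : walk σ x₀ w₀ = p₀.2 := by rw [← hw₀, walk_prodPerm]
  set t := z p₀.1 with ht
  have htl : (FreeGroup.invRev t).length ≤ C.sup fun c => (z c).length := by
    rw [FreeGroup.invRev_length]
    exact le_sup (f := fun c => (z c).length) hpC
  have hback : walk (cosetPerm Δ) p₀.1 (FreeGroup.invRev t) = y₀ := by
    rw [← hz p₀.1, ← ht, walk_invRev]
  have hW1 : ∀ k, walk (cosetPerm Δ) p₀.1 (W k) = p₀.1 := fun k => by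
    have := congrArg Prod.fst (hW k)
    rwa [walk_prodPerm] at this
  have hW2 : ∀ k, walk σ p₀.2 (W k) = p₀.2 := fun k => by
    have := congrArg Prod.snd (hW k)
    rwa [walk_prodPerm] at this
  -- Transporting the base point along `t` conjugates the labels of the loops into `Δ`.
  set v := walk σ p₀.2 (FreeGroup.invRev t) with hv
  have hvt : walk σ v t = p₀.2 := walk_walk_invRev σ _ _
  refine ⟨v, fun k => FreeGroup.mk (t ++ (W k ++ FreeGroup.invRev t)), e,
    ⟨FreeGroup.mk (w₀ ++ FreeGroup.invRev t), ?_, ?_⟩, fun k => ⟨?_, ?_⟩, fun j k => ?_⟩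
  · rw [← walk_cosetPerm_eq_iff, ← hy₀, walk_append, hw1, hback]
  · rw [FreeGroup.toWord_mk, walk_congr σ (w' := w₀ ++ FreeGroup.invRev t) FreeGroup.reduce.self,
      walk_append, hw2]
  · rw [← walk_cosetPerm_eq_iff, ← hy₀, walk_append, hz, walk_append, hW1, hback]
  · rw [FreeGroup.toWord_mk, walk_congr σ (w' := t ++ (W k ++ FreeGroup.invRev t))
      FreeGroup.reduce.self, walk_append, hvt, walk_append, hW2]
  · rw [FreeGroup.toWord_mk]
    -- The two tails avoid `e k`, so before reduction the count is zero or one; an even change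
    -- cannot alter it.
    obtain ⟨n, hn⟩ := count_edges_reduce (σ := σ) v (t ++ (W j ++ FreeGroup.invRev t)) (e k)
    have h1 : e k ∉ edges σ v t := by
      have := edges_invRev (σ := σ) p₀.2 (FreeGroup.invRev t)
      rw [FreeGroup.invRev_invRev, ← hv] at this
      rw [this, List.mem_reverse]
      exact hL k _ htl
    rw [edges_append, hvt, edges_append, hW2, List.count_append, List.count_append, hcount,
      List.count_eq_zero.2 h1, List.count_eq_zero.2 (hL k _ htl)] at hn
    split_ifs at hn ⊢ <;> omega

end CosetLoops

/-! ### Averaging over measure preserving maps -/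

section Averaging

variable {A B : Type*} [MeasurableSpace A] [MeasurableSpace B]

/-- Tonelli: a random transformation, each instance of which preserves `κ`, preserves integrals on
average. -/
theorem lintegral_eq_lintegral_average {ν : Measure A} [IsProbabilityMeasure ν] {κ : Measure B}
    [SFinite κ] {T : A → B → B} (hT : Measurable (Function.uncurry T))
    (hκ : ∀ a, MeasurePreserving (T a) κ κ) {f : B → ENNReal} (hf : Measurable f) :
    ∫⁻ b, f b ∂κ = ∫⁻ b, ∫⁻ a, f (T a b) ∂ν ∂κ := by
  rw [← lintegral_lintegral_swap (f := fun a b => f (T a b)) (hf.comp hT).aemeasurable]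
  have : ∀ a, ∫⁻ b, f (T a b) ∂κ = ∫⁻ b, f b ∂κ := fun a => (hκ a).lintegral_comp hf
  simp [this]

/-- It suffices to find the law of `Φ` after rerandomizing an almost arbitrary fixed `b`. The total
mass of `κ` appears since `κ` need not be normalized. -/
theorem map_eq_of_average {Z : Type*} [MeasurableSpace Z] {ν : Measure A} [IsProbabilityMeasure ν]
    {κ : Measure B} [SFinite κ] {T : A → B → B} (hT : Measurable (Function.uncurry T))
    (hκ : ∀ a, MeasurePreserving (T a) κ κ) {Φ : B → Z} (hΦ : Measurable Φ) {θ : Measure Z}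
    (h : ∀ᵐ b ∂κ, MeasurePreserving (fun a => Φ (T a b)) ν θ) :
    Measure.map Φ κ = κ Set.univ • θ := by
  ext S hS
  rw [Measure.map_apply hΦ hS, ← lintegral_indicator_one (hΦ hS),
    lintegral_eq_lintegral_average hT hκ (measurable_one.indicator (hΦ hS)) (ν := ν)]
  have : ∀ᵐ b ∂κ, ∫⁻ a, (Φ ⁻¹' S).indicator 1 (T a b) ∂ν = θ S := by
    filter_upwards [h] with b hb
    rw [← hb.measure_preimage hS.nullMeasurableSet, ← lintegral_indicator_one (hb.measurable hS)]
    rfl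
  rw [lintegral_congr_ae this, lintegral_const, mul_comm]
  rfl

end Averaging

/-! ### Words -/

section Words

variable {G : Type*} [Group G] {E : Type*}

/-- The value of a word in the letters `x` and `x⁻¹`, `x ∈ E`. -/
def ev (b : E → G) (l : List (E × Bool)) : G :=
  (l.map fun a => bif a.2 then b a.1 else (b a.1)⁻¹).prod

theorem ev_append (b : E → G) (l l' : List (E × Bool)) : ev b (l ++ l') = ev b l * ev b l' := by
  simp [ev]

theorem ev_cons (b : E → G) (a : E × Bool) (l : List (E × Bool)) :
    ev b (a :: l) = (bif a.2 then b a.1 else (b a.1)⁻¹) * ev b l := by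
  simp [ev]

theorem ev_congr {b b' : E → G} {l : List (E × Bool)} (h : ∀ x ∈ l.map Prod.fst, b x = b' x) :
    ev b l = ev b' l := by
  unfold ev
  congr 1
  refine List.map_congr_left fun a ha => ?_
  rw [h a.1 (List.mem_map_of_mem ha)]

/-- The private letter splits the word, and the two remaining parts contain none of the letters that
`h` alters. -/
theorem exists_ev_eq [DecidableEq E] {K : ℕ} {e : Fin K → E} (b : E → G) {l : List (E × Bool)}
    {k : Fin K} (hl : ∀ j, (l.map Prod.fst).count (e j) = if k = j then 1 else 0) :
    ∃ (p q : G) (s : Bool), ∀ h : E → G, (∀ x, (∀ j, e j ≠ x) → h x = 1) →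
      ev (h * b) l = p * (bif s then h (e k) else (h (e k))⁻¹) * q := by
  have hmem : e k ∈ l.map Prod.fst := by
    rw [← List.count_pos_iff, hl, if_pos rfl]
    exact one_pos
  obtain ⟨⟨x, s⟩, hxs, hx⟩ := List.mem_map.1 hmem
  simp only at hx
  obtain ⟨l₁, l₂, rfl⟩ := List.append_of_mem hxs
  have hno : ∀ j, e j ∉ l₁.map Prod.fst ∧ e j ∉ l₂.map Prod.fst := by
    intro j
    have := hl j
    rw [List.map_append, List.map_cons, List.count_append, List.count_cons, hx] at this
    rw [← List.count_eq_zero, ← List.count_eq_zero]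
    by_cases hkj : k = j
    · subst hkj
      simp at this
      omega
    · simp [hkj] at this
      omega
  have hev : ∀ h : E → G, (∀ x, (∀ j, e j ≠ x) → h x = 1) →
      ev (h * b) l₁ = ev b l₁ ∧ ev (h * b) l₂ = ev b l₂ := by
    intro h hh
    constructor <;> refine ev_congr fun x hx => ?_
    · rw [Pi.mul_apply, hh x fun j hj => (hno j).1 (hj ▸ hx), one_mul]
    · rw [Pi.mul_apply, hh x fun j hj => (hno j).2 (hj ▸ hx), one_mul]
  cases s
  · refine ⟨ev b l₁ * (b x)⁻¹, ev b l₂, false, fun h hh => ?_⟩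
    rw [ev_append, ev_cons, (hev h hh).1, (hev h hh).2, ← hx]
    simp [mul_assoc]
  · refine ⟨ev b l₁, b x * ev b l₂, true, fun h hh => ?_⟩
    rw [ev_append, ev_cons, (hev h hh).1, (hev h hh).2, ← hx]
    simp [mul_assoc]

theorem measurable_ev [TopologicalSpace G] [IsTopologicalGroup G] [MeasurableSpace G] [BorelSpace G]
    [SecondCountableTopology G] (l : List (E × Bool)) :
    Measurable fun b : E → G => ev b l := by
  induction l with
  | nil => simp [ev]
  | cons a l ih =>
    simp only [ev_cons]
    refine Measurable.mul ?_ ih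
    cases a.2
    · exact (measurable_pi_apply _).inv
    · exact measurable_pi_apply _

end Words

/-! ### Random words with independent Haar entries -/

section HaarWords

variable {G : Type*} [Group G] [TopologicalSpace G] [IsTopologicalGroup G] [CompactSpace G]
  [MeasurableSpace G] [BorelSpace G] {μ : Measure G} [IsProbabilityMeasure μ] [μ.IsHaarMeasure]

theorem eq_haar_of_isMulLeftInvariant (μ ν : Measure G) [IsProbabilityMeasure μ] [μ.IsHaarMeasure]
    [IsProbabilityMeasure ν] [ν.IsMulLeftInvariant] : ν = μ := by
  have : ν.IsHaarMeasure := Measure.isHaarMeasure_of_isCompact_nonempty_interior ν Set.univ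
    isCompact_univ (by simp) (by simp) (by simp)
  exact Measure.isHaarMeasure_eq_of_isProbabilityMeasure ν μ

/-- Compact groups are unimodular: a right translate of `μ` is again a left-invariant probability
measure, so uniqueness applies. -/
theorem measurePreserving_mul_right_of_compact (g : G) : MeasurePreserving (· * g) μ μ := by
  refine ⟨measurable_mul_const g, ?_⟩
  have : IsProbabilityMeasure (μ.map (· * g)) :=
    Measure.isProbabilityMeasure_map (measurable_mul_const g).aemeasurable
  exact eq_haar_of_isMulLeftInvariant μ _

theorem measurePreserving_inv_of_compact : MeasurePreserving (fun g : G => g⁻¹) μ μ := by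
  refine ⟨measurable_inv, ?_⟩
  have : μ.IsMulRightInvariant := ⟨fun g => (measurePreserving_mul_right_of_compact g).map_eq⟩
  have : IsProbabilityMeasure μ.inv := Measure.isProbabilityMeasure_map measurable_inv.aemeasurable
  exact eq_haar_of_isMulLeftInvariant μ μ.inv

/-- Words in independent Haar-random elements are independent and Haar-random if each of them has a
letter of its own which it contains exactly once. -/
theorem measurePreserving_ev [SecondCountableTopology G] {E : Type*} [Fintype E] [DecidableEq E]
    {K : ℕ}
    {e : Fin K → E} {l : Fin K → List (E × Bool)}
    (hl : ∀ k j, ((l k).map Prod.fst).count (e j) = if k = j then 1 else 0) :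
    MeasurePreserving (fun (b : E → G) k => ev b (l k)) (Measure.pi fun _ => μ)
      (Measure.pi fun _ => μ) := by
  have hinj : Function.Injective e := by
    intro i j hij
    have := hl i j
    rw [← hij, hl i i, if_pos rfl] at this
    by_contra hne
    simp [hne] at this
  refine ⟨measurable_pi_lambda _ fun k => measurable_ev (l k), ?_⟩
  let ext : (Fin K → G) → E → G := fun h => Function.extend e h 1
  have hext : Measurable ext := by
    refine measurable_pi_lambda _ fun x => ?_
    by_cases hx : ∃ k, e k = x
    · obtain ⟨k, rfl⟩ := hx
      simp only [ext, hinj.extend_apply]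
      exact measurable_pi_apply k
    · simp only [ext, Function.extend_apply' _ _ _ hx]
      exact measurable_const
  -- Only the private letters are rerandomized. With everything else fixed, the `k`-th word is `p k
  -- * h ^ (±1) * q k` with its own Haar-random `h`.
  have := map_eq_of_average (ν := Measure.pi fun _ : Fin K => μ) (κ := Measure.pi fun _ : E => μ)
    (T := fun h b => ext h * b) (Φ := fun b k => ev b (l k)) (θ := Measure.pi fun _ : Fin K => μ)
    ((hext.comp measurable_fst).mul measurable_snd)
    (fun h => measurePreserving_mul_left _ _) (measurable_pi_lambda _ fun k => measurable_ev (l k))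
    (Filter.Eventually.of_forall fun b => ?_)
  · rw [this]; simp
  · choose p q s hpq using fun k => exists_ev_eq b (hl k)
    have h1 : (fun (a : Fin K → G) k => ev (ext a * b) (l k)) =
        fun a k => p k * (bif s k then a k else (a k)⁻¹) * q k := by
      funext a k
      rw [hpq k (ext a) fun x hx => Function.extend_apply' _ _ _ fun ⟨j, hj⟩ => hx j hj]
      simp only [ext, hinj.extend_apply]
    rw [h1]
    refine measurePreserving_pi _ _
      (f := fun k (g : G) => p k * (bif s k then g else g⁻¹) * q k) fun k => ?_
    refine (measurePreserving_mul_right_of_compact (q k)).comp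
      (g := fun g => g * q k) (f := fun g : G => p k * (bif s k then g else g⁻¹)) ?_
    refine (measurePreserving_mul_left μ (p k)).comp
      (g := fun g => p k * g) (f := fun g : G => bif s k then g else g⁻¹) ?_
    cases s k
    · exact measurePreserving_inv_of_compact
    · exact MeasurePreserving.id μ

end HaarWords

/-! ### Levels -/

section Levels

variable {d m : ℕ} {H : Subgroup (Equiv.Perm (Fin d))}

theorem W.act_mul (g h : W H) (v : Vertex d) : (g * h).act v = h.act (g.act v) := rfl

theorem W.act_inv_act (g : W H) (v : Vertex d) : g⁻¹.act (g.act v) = v :=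
  RandomTree.act_inv_act g.1 v

theorem W.act_act_inv (g : W H) (v : Vertex d) : g.act (g⁻¹.act v) = v :=
  RandomTree.act_act_inv g.1 v

theorem W.length_act (g : W H) (v : Vertex d) : (g.act v).length = v.length :=
  RandomTree.length_act g.1 v

theorem W.act_append (g : W H) (v u : Vertex d) :
    g.act (v ++ u) = g.act v ++ (g.cocycle v).act u := act_localCocycle g.1 v u

theorem W.cocycle_mul (g h : W H) (v : Vertex d) :
    (g * h).cocycle v = g.cocycle v * h.cocycle (g.act v) := Subtype.ext (localCocycle_mul g.1 h.1 v)

theorem W.cocycle_one (v : Vertex d) : (1 : W H).cocycle v = 1 := Subtype.ext (localCocycle_one v)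

theorem W.cocycle_inv (g : W H) (v : Vertex d) : g⁻¹.cocycle v = (g.cocycle (g⁻¹.act v))⁻¹ := by
  rw [eq_inv_iff_mul_eq_one]
  have := W.cocycle_mul g⁻¹ g v
  rw [inv_mul_cancel, W.cocycle_one] at this
  exact this.symm

theorem W.ext_act {g h : W H} (hgh : ∀ v, g.act v = h.act v) : g = h :=
  Subtype.ext (RandomTree.ext_act hgh)

/-- The level `n` of the tree. -/
abbrev Lv (d n : ℕ) : Type := {x : Vertex d // x.length = n}

instance (n : ℕ) : Fintype (Lv d n) := inferInstanceAs (Fintype (List.Vector (Fin d) n))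

/-- The permutation of a level given by an element of `W(H)`. -/
def levPerm (g : W H) (n : ℕ) : Equiv.Perm (Lv d n) where
  toFun x := ⟨g.act x, by rw [W.length_act, x.2]⟩
  invFun x := ⟨g⁻¹.act x, by rw [W.length_act, x.2]⟩
  left_inv x := Subtype.ext (W.act_inv_act g x)
  right_inv x := Subtype.ext (W.act_act_inv g x)

/-- The action on a level. -/
def lev (φ : Sample m H) (n : ℕ) (i : Fin m) : Equiv.Perm (Lv d n) := levPerm (φ i) n

/-- The local cocycles of the generators at the vertices of a level. -/
def bfun (φ : Sample m H) (n : ℕ) (a : Lv d n × Fin m) : W H := (φ a.2).cocycle a.1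

/-- The signed geometric edges traversed by a walk. -/
def spath {X : Type*} (σ : Fin m → Equiv.Perm X) : X → List (Fin m × Bool) →
    List ((X × Fin m) × Bool)
  | _, [] => []
  | x, s :: w => (geo σ x s, s.2) :: spath σ (step σ s x) w

theorem map_fst_spath {X : Type*} (σ : Fin m → Equiv.Perm X) (x : X) (w : List (Fin m × Bool)) :
    (spath σ x w).map Prod.fst = edges σ x w := by
  induction w generalizing x with
  | nil => rfl
  | cons s w ih => simp [spath, edges, ih]

theorem hom_mk_cons (φ : Sample m H) (s : Fin m × Bool) (w : List (Fin m × Bool)) :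
    hom φ (FreeGroup.mk (s :: w)) =
      (bif s.2 then φ s.1 else (φ s.1)⁻¹) * hom φ (FreeGroup.mk w) := by
  have h : FreeGroup.mk (s :: w) = FreeGroup.mk [s] * FreeGroup.mk w := by
    rw [FreeGroup.mul_mk]; rfl
  rw [h, map_mul]
  simp [hom]

theorem act_letter (φ : Sample m H) (s : Fin m × Bool) {n : ℕ} (x : Lv d n) :
    (bif s.2 then φ s.1 else (φ s.1)⁻¹).act x = (step (lev φ n) s x).1 := by
  rcases s with ⟨i, b⟩
  cases b <;> rfl

theorem walk_lev (φ : Sample m H) {n : ℕ} (x : Lv d n) (w : List (Fin m × Bool)) :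
    (walk (lev φ n) x w).1 = (hom φ (FreeGroup.mk w)).act x := by
  induction w generalizing x with
  | nil => rfl
  | cons s w ih => rw [walk_cons, ih, hom_mk_cons, W.act_mul, act_letter]

/-- The cocycle identity multiplies the labels along the path; an edge crossed backwards contributes
the inverse of its label. -/
theorem cocycle_hom (φ : Sample m H) {n : ℕ} (x : Lv d n) (w : List (Fin m × Bool)) :
    (hom φ (FreeGroup.mk w)).cocycle x = ev (bfun φ n) (spath (lev φ n) x w) := by
  induction w generalizing x with
  | nil =>
    have h : hom φ (FreeGroup.mk []) = 1 := map_one _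
    rw [h, W.cocycle_one]
    rfl
  | cons s w ih =>
    rw [hom_mk_cons, W.cocycle_mul, act_letter, ih, spath, ev_cons]
    congr 1
    rcases s with ⟨i, b⟩
    cases b
    · exact W.cocycle_inv (φ i) x
    · rfl

theorem pathEdges_eq (φ : Sample m H) {n : ℕ} (x : Lv d n) (w : List (Fin m × Bool)) :
    pathEdges φ x w = (edges (lev φ n) x w).map (Prod.map Subtype.val id) := by
  induction w generalizing x with
  | nil => rfl
  | cons s w ih =>
    rcases s with ⟨i, b⟩
    cases b
    · have := ih (step (lev φ n) (i, false) x)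
      rw [← act_letter] at this
      simpa [pathEdges, edges, geo, ← act_letter] using this
    · have := ih (step (lev φ n) (i, true) x)
      rw [← act_letter] at this
      simpa [pathEdges, edges, geo, ← act_letter] using this

theorem lev_eq_iff {φ ψ : Sample m H} {n : ℕ} :
    lev φ n = lev ψ n ↔ ∀ i, ∀ x : Vertex d, x.length = n → (φ i).act x = (ψ i).act x := by
  constructor
  · intro h i x hx
    have := congrArg (fun f => (f i ⟨x, hx⟩).1) h
    exact this
  · intro h
    funext i
    ext x : 1
    exact Subtype.ext (h i x.1 x.2)

/-! ### Measurability -/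

instance : SecondCountableTopology (W H) := by
  let _ : TopologicalSpace (Vertex d) := ⊥
  have _ : DiscreteTopology (Vertex d) := ⟨rfl⟩
  exact TopologicalSpace.secondCountableTopology_induced _ _ _

instance : IsProbabilityMeasure (haar H) :=
  ⟨by simpa [haar] using Measure.haarMeasure_self (K₀ := (⊤ : TopologicalSpace.PositiveCompacts (W H)))⟩

instance : (haar H).IsHaarMeasure := Measure.isHaarMeasure_haarMeasure ⊤

instance : IsProbabilityMeasure (law m H) := inferInstanceAs (IsProbabilityMeasure (Measure.pi _))

instance : (law m H).IsMulLeftInvariant :=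
  inferInstanceAs (Measure.IsMulLeftInvariant (Measure.pi fun _ => haar H))

theorem W.isOpen_act (v : Vertex d) (p : Vertex d → Prop) : IsOpen {g : W H | p (g.act v)} := by
  have : {g : W H | p (g.act v)} = ⋃ w ∈ {w | p w}, {g : W H | g.act v = w} := by
    ext g
    simp
  rw [this]
  exact isOpen_biUnion fun w _ => W.isOpen_act_eq v w

theorem W.measurableSet_act (v : Vertex d) (p : Vertex d → Prop) :
    MeasurableSet {g : W H | p (g.act v)} := (W.isOpen_act v p).measurableSet

theorem measurableSet_lev_eq (n : ℕ) (σ : Fin m → Equiv.Perm (Lv d n)) :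
    MeasurableSet {φ : Sample m H | lev φ n = σ} := by
  have : {φ : Sample m H | lev φ n = σ} =
      ⋂ i, ⋂ x : Lv d n, (fun φ => φ i) ⁻¹' {g : W H | g.act x = (σ i x).1} := by
    ext φ
    simp only [Set.mem_ofPred_eq, Set.mem_iInter, Set.mem_preimage]
    constructor
    · rintro rfl i x
      rfl
    · intro h
      funext i
      ext x : 1
      exact Subtype.ext (h i x)
  rw [this]
  exact MeasurableSet.iInter fun i => MeasurableSet.iInter fun x =>
    measurable_pi_apply i (W.measurableSet_act x.1 (· = (σ i x).1))

theorem measurableSet_lev (n : ℕ) (p : (Fin m → Equiv.Perm (Lv d n)) → Prop) :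
    MeasurableSet {φ : Sample m H | p (lev φ n)} := by
  have : {φ : Sample m H | p (lev φ n)} = ⋃ σ ∈ {σ | p σ}, {φ : Sample m H | lev φ n = σ} := by
    ext φ
    simp
  rw [this]
  exact MeasurableSet.biUnion (Set.to_countable _) fun σ _ => measurableSet_lev_eq n σ

theorem W.continuous_cocycle (v : Vertex d) : Continuous fun g : W H => g.cocycle v :=
  W.continuous_iff.2 fun u w =>
    W.isOpen_act (H := H) (v ++ u) (fun y => y.drop v.length = w)

theorem W.measurable_cocycle (v : Vertex d) : Measurable fun g : W H => g.cocycle v :=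
  (W.continuous_cocycle v).measurable

theorem measurable_bfun (n : ℕ) : Measurable fun φ : Sample m H => bfun φ n :=
  measurable_pi_lambda _ fun a => (W.measurable_cocycle a.1.1).comp (measurable_pi_apply a.2)

/-! ### Modifying an element below a level -/

theorem portraitAct_eq_self {p : Vertex d → Equiv.Perm (Fin d)} {v : Vertex d}
    (h : ∀ w, w.length < v.length → p w = 1) : portraitAct p v = v := by
  induction v generalizing p with
  | nil => rfl
  | cons a v ih =>
    rw [portraitAct, h [] (by simp), ih fun w hw => h _ (by simpa using hw)]
    rfl

/-- The portrait of the element with prescribed local cocycles at a level that fixes this level. -/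
def diagPortrait {n : ℕ} (h : Lv d n → W H) (v : Vertex d) : Equiv.Perm (Fin d) :=
  if hv : v.length < n then 1 else
    rootPerm (localCocycle (h ⟨v.take n, by simp at hv ⊢; omega⟩).1 (v.drop n))

/-- The element with prescribed local cocycles at a level that fixes this level. -/
noncomputable def diag {n : ℕ} (h : Lv d n → W H) : W H :=
  ⟨ofPortrait (diagPortrait h), fun v => by
    rw [rootPerm_ofPortrait, diagPortrait]
    split_ifs
    · exact H.one_mem
    · exact (h _).2 _⟩

theorem act_diag_of_length_le {n : ℕ} (h : Lv d n → W H) {v : Vertex d} (hv : v.length ≤ n) :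
    (diag h).act v = v :=
  portraitAct_eq_self fun w hw => by rw [diagPortrait, dif_pos (by omega)]

theorem act_diag_append {n : ℕ} (h : Lv d n → W H) (x : Lv d n) (u : Vertex d) :
    (diag h).act (x.1 ++ u) = x.1 ++ (h x).act u := by
  have h1 : (diag h).act (x.1 ++ u) = (diag h).act x.1 ++
      portraitAct (fun w => diagPortrait h (x.1 ++ w)) u := portraitAct_append _ _ _
  rw [h1, act_diag_of_length_le h x.2.le]
  congr 1
  have h2 : (fun w => diagPortrait h (x.1 ++ w)) = fun w => rootPerm (localCocycle (h x).1 w) := by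
    funext w
    have hx := x.2
    rw [diagPortrait, dif_neg (by simp; omega)]
    have h3 : (x.1 ++ w).take n = x.1 := List.take_left' hx
    have h4 : (x.1 ++ w).drop n = w := List.drop_left' hx
    have h5 : (⟨(x.1 ++ w).take n, by rw [h3, hx]⟩ : Lv d n) = x := Subtype.ext h3
    rw [h5, h4]
  rw [h2, portraitAct_cocycle]
  rfl

theorem cocycle_diag {n : ℕ} (h : Lv d n → W H) (x : Lv d n) : (diag h).cocycle x = h x := by
  refine W.ext_act fun u => List.append_cancel_left (as := (diag h).act x.1) ?_
  rw [← W.act_append, act_diag_append, act_diag_of_length_le h x.2.le]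

theorem continuous_diag (n : ℕ) : Continuous fun h : Lv d n → W H => diag h := by
  refine W.continuous_iff.2 fun v w => ?_
  rcases le_total v.length n with hv | hv
  · simp only [act_diag_of_length_le _ hv]
    exact isOpen_const
  · let x : Lv d n := ⟨v.take n, by simp; omega⟩
    have hx : v = x.1 ++ v.drop n := (List.take_append_drop n v).symm
    rw [hx]
    simp only [act_diag_append]
    exact (W.isOpen_act (H := H) (v.drop n) (fun y => x.1 ++ y = w)).preimage
      (continuous_apply (A := fun _ : Lv d n => W H) x)

/-- Multiplication of the local cocycles at a level by given elements. -/
noncomputable def modify (n : ℕ) (h : Lv d n × Fin m → W H) (φ : Sample m H) : Sample m H :=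
  (fun i => diag fun x => h (x, i)) * φ

theorem lev_modify (n : ℕ) (h : Lv d n × Fin m → W H) (φ : Sample m H) :
    lev (modify n h φ) n = lev φ n := by
  refine lev_eq_iff.2 fun i x hx => ?_
  change (φ i).act ((diag _).act x) = _
  rw [act_diag_of_length_le _ hx.le]

theorem bfun_modify (n : ℕ) (h : Lv d n × Fin m → W H) (φ : Sample m H) :
    bfun (modify n h φ) n = h * bfun φ n := by
  funext ⟨x, i⟩
  change (diag (fun x => h (x, i)) * φ i).cocycle x = _
  rw [W.cocycle_mul, cocycle_diag, act_diag_of_length_le _ x.2.le]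
  rfl

theorem measurable_modify (n : ℕ) :
    Measurable (Function.uncurry (modify n (m := m) (H := H))) := by
  refine Measurable.mul ?_ measurable_snd
  refine measurable_pi_lambda _ fun i => ?_
  refine (continuous_diag n).measurable.comp (measurable_pi_lambda _ fun x => ?_)
  exact (measurable_pi_apply (x, i)).comp measurable_fst

theorem measurePreserving_modify (n : ℕ) (h : Lv d n × Fin m → W H) :
    MeasurePreserving (modify n h) (law m H) (law m H) :=
  measurePreserving_mul_left _ _

theorem measurePreserving_mul_bfun {E : Type*} [Fintype E] (b : E → W H) :
    MeasurePreserving (fun h : E → W H => h * b) (Measure.pi fun _ => haar H)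
      (Measure.pi fun _ => haar H) :=
  measurePreserving_pi _ _ (f := fun a (g : W H) => g * b a)
    fun a => measurePreserving_mul_right_of_compact (b a)

/-- The local cocycles at a level are independent of the action on this level, and they are
independent and Haar-random. -/
theorem lintegral_lev_bfun (n : ℕ)
    {f : (Fin m → Equiv.Perm (Lv d n)) → (Lv d n × Fin m → W H) → ENNReal}
    (hf : ∀ σ, Measurable (f σ)) :
    ∫⁻ φ, f (lev φ n) (bfun φ n) ∂(law m H) =
      ∫⁻ φ, ∫⁻ b, f (lev φ n) b ∂(Measure.pi fun _ => haar H) ∂(law m H) := by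
  have hm : Measurable fun φ : Sample m H => f (lev φ n) (bfun φ n) := by
    have : (fun φ : Sample m H => f (lev φ n) (bfun φ n)) =
        fun φ => ∑ σ, {φ : Sample m H | lev φ n = σ}.indicator (fun φ => f σ (bfun φ n)) φ := by
      funext φ
      rw [Finset.sum_eq_single (lev φ n)]
      · simp
      · intro σ _ hσ
        exact Set.indicator_of_notMem (fun h => hσ h.symm) _
      · simp
    rw [this]
    exact Finset.measurable_sum _ fun σ _ =>
      ((hf σ).comp (measurable_bfun n)).indicator (measurableSet_lev_eq n σ)
  -- Left multiplication by elements that fix level `n` keeps the action on this level and replaces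
  -- the labels by `h * bfun φ n`, which is Haar-distributed for random `h`.
  rw [lintegral_eq_lintegral_average (measurable_modify n) (measurePreserving_modify n) hm
    (ν := Measure.pi fun _ => haar H)]
  refine lintegral_congr fun φ => ?_
  simp only [lev_modify, bfun_modify]
  exact (measurePreserving_mul_bfun (bfun φ n)).lintegral_comp (hf _)

theorem map_bfun_cond (n : ℕ) (σ : Fin m → Equiv.Perm (Lv d n))
    (h0 : law m H {φ | lev φ n = σ} ≠ 0) :
    MeasurePreserving (fun φ => bfun φ n) (cond (law m H) {φ | lev φ n = σ})
      (Measure.pi fun _ => haar H) := by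
  refine ⟨measurable_bfun n, ?_⟩
  ext S hS
  rw [Measure.map_apply (measurable_bfun n) hS,
    cond_apply (measurableSet_lev_eq n σ)]
  have h1 := lintegral_lev_bfun (H := H) n (f := fun τ => if τ = σ then S.indicator 1 else 0)
    (fun τ => by
      split_ifs
      · exact measurable_one.indicator hS
      · exact measurable_const)
  have h2 : (fun φ : Sample m H => (if lev φ n = σ then S.indicator 1 else 0 :
      (Lv d n × Fin m → W H) → ENNReal) (bfun φ n)) =
      ({φ | lev φ n = σ} ∩ (fun φ => bfun φ n) ⁻¹' S).indicator 1 := by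
    funext φ
    by_cases hφ : lev φ n = σ <;> by_cases hS : bfun φ n ∈ S <;> simp [hφ, hS]
  have h3 : (fun φ : Sample m H => ∫⁻ b, (if lev φ n = σ then S.indicator 1 else 0 :
      (Lv d n × Fin m → W H) → ENNReal) b ∂(Measure.pi fun _ => haar H)) =
      {φ | lev φ n = σ}.indicator fun _ => (Measure.pi fun _ => haar H) S := by
    funext φ
    by_cases hφ : lev φ n = σ <;> simp [hφ, lintegral_indicator_one hS]
  rw [h2, h3, lintegral_indicator_one ((measurableSet_lev_eq n σ).inter (measurable_bfun n hS)),
    lintegral_indicator_const (measurableSet_lev_eq n σ)] at h1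
  rw [h1, mul_comm, mul_assoc, ENNReal.mul_inv_cancel h0 (measure_ne_top _ _), mul_one]

end Levels

/-! ### Fixed vertices of random elements -/

section FixedVertices

variable {d m : ℕ} {H : Subgroup (Equiv.Perm (Fin d))}

/-- A second passage in the same direction closes a proper prefix of `s :: w`. One in the opposite
direction closes a prefix of `w`, which is nonempty because `s :: w` is reduced. -/
theorem not_mem_edges_of_girth {X : Type*} {σ : Fin m → Equiv.Perm X} {s : Fin m × Bool}
    {w : List (Fin m × Bool)} (hG : Girth σ w.length) (hw : FreeGroup.IsReduced (s :: w)) (x : X) :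
    geo σ x s ∉ edges σ (step σ s x) w := by
  intro h
  obtain ⟨w₁, t, w₂, rfl, he⟩ := mem_edges h
  rcases geo_eq_geo he with ⟨h1, -⟩ | ⟨h1, h2⟩
  · refine hG (s :: w₁) (hw.infix ⟨[], t :: w₂, by simp⟩) (by simp) (by simp) x ?_
    rw [walk_cons, h1]
  · rcases w₁ with _ | ⟨r, w₁⟩
    · rw [List.nil_append, FreeGroup.isReduced_cons_cons] at hw
      have := hw.1
      rw [h2] at this
      simp [flip] at this
    · exact hG (r :: w₁) (hw.infix ⟨[s], t :: w₂, by simp⟩) (by simp) (by simp) _ h1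

/-- The number of vertices fixed by a word. -/
def fixCount {n : ℕ} (σ : Fin m → Equiv.Perm (Lv d n)) (w : List (Fin m × Bool)) : ℕ :=
  (Finset.univ.filter fun x => walk σ x w = x).card

/-- The number of vertices on the next level fixed by a word, in terms of the action on a level and
of the local cocycles. -/
def nextFix {n : ℕ} (σ : Fin m → Equiv.Perm (Lv d n)) (w : List (Fin m × Bool))
    (b : Lv d n × Fin m → W H) : ℕ :=
  ∑ x ∈ Finset.univ.filter fun x => walk σ x w = x,
    (Finset.univ.filter fun a : Fin d => (ev b (spath σ x w)).act [a] = [a]).card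

theorem walk_lev_eq_iff (φ : Sample m H) {n : ℕ} (x : Lv d n) (w : List (Fin m × Bool)) :
    walk (lev φ n) x w = x ↔ (hom φ (FreeGroup.mk w)).act x = x := by
  rw [← walk_lev, Subtype.ext_iff]

/-- A child is fixed exactly when its parent is fixed and the cocycle at the parent fixes the last
letter. -/
theorem fixCount_succ (φ : Sample m H) (n : ℕ) (w : List (Fin m × Bool)) :
    fixCount (lev φ (n + 1)) w = nextFix (lev φ n) w (bfun φ n) := by
  rw [fixCount, nextFix, ← Finset.card_sigma]
  symm
  refine Finset.card_bij (fun z _ => ⟨z.1.1 ++ [z.2], by simp [z.1.2]⟩) ?_ ?_ ?_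
  · rintro ⟨x, a⟩ hx
    simp only [Finset.mem_sigma, Finset.mem_filter, Finset.mem_univ, true_and] at hx ⊢
    rw [walk_lev_eq_iff, ← cocycle_hom] at hx
    rw [walk_lev_eq_iff, W.act_append, hx.1, hx.2]
  · rintro ⟨x, a⟩ _ ⟨y, c⟩ _ h
    have h1 := (List.append_inj (Subtype.mk.inj h) (by simp [x.2, y.2]))
    have h2 : x = y := Subtype.ext h1.1
    have h3 : a = c := by simpa using h1.2
    rw [h2, h3]
  · rintro ⟨y, hy⟩ hfix
    simp only [Finset.mem_filter, Finset.mem_univ, true_and, walk_lev_eq_iff] at hfix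
    have hne : y ≠ [] := by rintro rfl; simp at hy
    have hyy := List.dropLast_append_getLast hne
    let x : Lv d n := ⟨y.dropLast, by simp [hy]⟩
    rw [← hyy, W.act_append] at hfix
    have h1 := List.append_inj hfix (by rw [W.length_act])
    refine ⟨⟨x, y.getLast hne⟩, ?_, Subtype.ext hyy⟩
    simp only [Finset.mem_sigma, Finset.mem_filter, Finset.mem_univ, true_and]
    rw [walk_lev_eq_iff, ← cocycle_hom]
    exact h1

theorem measurable_nextFix {n : ℕ} (σ : Fin m → Equiv.Perm (Lv d n)) (w : List (Fin m × Bool)) :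
    Measurable fun b : Lv d n × Fin m → W H => nextFix σ w b := by
  unfold nextFix
  simp only [Finset.card_filter]
  refine Finset.measurable_sum _ fun x _ => Finset.measurable_sum _ fun a _ => ?_
  exact Measurable.ite (measurable_ev _ (W.measurableSet_act [a] (· = [a]))) measurable_const
    measurable_const

theorem count_cons_eq_one {E : Type*} [DecidableEq E] {a : E} {l : List E} (h : a ∉ l) :
    (a :: l).count a = 1 := by
  rw [List.count_cons_self, List.count_eq_zero.2 h]

theorem measurePreserving_ev_spath {n : ℕ} {σ : Fin m → Equiv.Perm (Lv d n)} {s : Fin m × Bool}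
    {w : List (Fin m × Bool)} (hG : Girth σ w.length) (hw : FreeGroup.IsReduced (s :: w))
    (x : Lv d n) :
    MeasurePreserving (fun b : Lv d n × Fin m → W H => ev b (spath σ x (s :: w)))
      (Measure.pi fun _ => haar H) (haar H) := by
  have h := measurePreserving_ev (μ := haar H) (K := 1) (e := fun _ => geo σ x s)
    (l := fun _ => spath σ x (s :: w)) (by
      intro k j
      rw [map_fst_spath, if_pos (Subsingleton.elim _ _)]
      exact count_cons_eq_one (not_mem_edges_of_girth hG hw x))
  exact (measurePreserving_eval (fun _ : Fin 1 => haar H) 0).comp h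

/-! ### Fixed letters of a Haar-random element -/

/-- The element that acts on the first letter only. -/
noncomputable def rootElement (η : H) : W H :=
  ⟨ofPortrait fun v => if v = [] then η else 1, fun v => by
    rw [rootPerm_ofPortrait]
    split_ifs
    · exact η.2
    · exact H.one_mem⟩

theorem act_rootElement (η : H) (a : Fin d) : (rootElement η).act [a] = [η.1 a] := by
  change portraitAct (fun v => if v = [] then (η : Equiv.Perm (Fin d)) else 1) [a] = _
  simp [portraitAct]

/-- As `H` is transitive, right translations by elements acting only on the first letter permute the
`d` possible images of `a` transitively. -/
theorem haar_act_eq [MulAction.IsPretransitive H (Fin d)] (a c : Fin d) :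
    haar H {g | g.act [a] = [c]} = (d : ENNReal)⁻¹ := by
  have h1 : ∀ c', haar H {g | g.act [a] = [c']} = haar H {g | g.act [a] = [c]} := by
    intro c'
    obtain ⟨η, hη⟩ := MulAction.exists_smul_eq H c' c
    have hη' : η.1 c' = c := hη
    rw [← (measurePreserving_mul_right_of_compact (μ := haar H) (rootElement η)).measure_preimage
      (W.measurableSet_act [a] (· = [c])).nullMeasurableSet]
    congr 1
    ext g
    simp only [Set.mem_preimage, Set.mem_ofPred_eq, W.act_mul]
    constructor
    · intro h
      rw [h, act_rootElement, hη']
    · intro h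
      have h2 := congrArg (rootElement η)⁻¹.act h
      rw [W.act_inv_act] at h2
      rw [h2, ← hη', ← act_rootElement, W.act_inv_act]
  have h2 : (Set.univ : Set (W H)) = ⋃ c', {g | g.act [a] = [c']} := by
    ext g
    obtain ⟨c', hc'⟩ := List.length_eq_one_iff.1 (W.length_act g [a])
    simp only [Set.mem_univ, Set.mem_iUnion, true_iff]
    exact ⟨c', hc'⟩
  have h3 : haar H Set.univ = 1 := measure_univ
  rw [h2, measure_iUnion (fun i j hij => Set.disjoint_left.2 fun g hi hj => hij (by
      simpa using (show [i] = [j] from hi.symm.trans hj)))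
    (fun c' => W.measurableSet_act [a] (· = [c']))] at h3
  simp only [h1, tsum_fintype, Finset.sum_const, Finset.card_univ, Fintype.card_fin,
    nsmul_eq_mul] at h3
  rw [mul_comm] at h3
  exact ENNReal.eq_inv_of_mul_eq_one_left h3

theorem haar_fix_pos : 0 < haar H {g | ∀ a, g.act [a] = [a]} := by
  have h : {g : W H | ∀ a, g.act [a] = [a]} = ⋂ a, {g | g.act [a] = [a]} := by
    ext g; simp
  refine IsOpen.measure_pos _ ?_ ⟨1, fun a => rfl⟩
  rw [h]
  exact isOpen_iInter_of_finite fun a => W.isOpen_act_eq [a] [a]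

/-- The martingale property: the cocycle at a fixed vertex is Haar-random, so each of its `d`
children is fixed with probability `1 / d`. -/
theorem lintegral_nextFix [MulAction.IsPretransitive H (Fin d)] (hd : 0 < d) {n : ℕ}
    {σ : Fin m → Equiv.Perm (Lv d n)} {s : Fin m × Bool}
    {w : List (Fin m × Bool)} (hG : Girth σ w.length) (hw : FreeGroup.IsReduced (s :: w)) :
    ∫⁻ b, (nextFix (H := H) σ (s :: w) b : ENNReal) ∂(Measure.pi fun _ => haar H) =
      fixCount σ (s :: w) := by
  simp only [nextFix, Finset.card_filter, Nat.cast_sum]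
  have hms : ∀ (x : Lv d n) (a : Fin d), MeasurableSet {b : Lv d n × Fin m → W H |
      (ev b (spath σ x (s :: w))).act [a] = [a]} := fun x a =>
    measurable_ev _ (W.measurableSet_act [a] (· = [a]))
  have hm : ∀ (x : Lv d n) (a : Fin d), Measurable fun b : Lv d n × Fin m → W H =>
      ((if (ev b (spath σ x (s :: w))).act [a] = [a] then 1 else 0 : ℕ) : ENNReal) := by
    intro x a
    simp only [Nat.cast_ite]
    exact Measurable.ite (hms x a) measurable_const measurable_const
  rw [lintegral_finsetSum _ fun x _ => Finset.measurable_sum _ fun a _ => hm x a]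
  have h1 : ∀ x : Lv d n, ∫⁻ b : Lv d n × Fin m → W H, ∑ a : Fin d,
      ((if (ev b (spath σ x (s :: w))).act [a] = [a] then 1 else 0 : ℕ) : ENNReal)
      ∂(Measure.pi fun _ => haar H) = 1 := by
    intro x
    rw [lintegral_finsetSum _ fun a _ => hm x a]
    have h2 : ∀ a : Fin d, ∫⁻ b : Lv d n × Fin m → W H,
        ((if (ev b (spath σ x (s :: w))).act [a] = [a] then 1 else 0 : ℕ) : ENNReal)
        ∂(Measure.pi fun _ => haar H) = (d : ENNReal)⁻¹ := by
      intro a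
      rw [← haar_act_eq (H := H) a a, ← (measurePreserving_ev_spath hG hw x).measure_preimage
        (W.measurableSet_act [a] (· = [a])).nullMeasurableSet]
      rw [← lintegral_indicator_one ((measurePreserving_ev_spath hG hw x).measurable
        (W.measurableSet_act [a] (· = [a])))]
      refine lintegral_congr fun b => ?_
      by_cases hb : (ev b (spath σ x (s :: w))).act [a] = [a] <;> simp [hb]
    simp only [h2, Finset.sum_const, Finset.card_univ, Fintype.card_fin, nsmul_eq_mul]
    exact ENNReal.mul_inv_cancel (by simp; omega) (by simp)
  simp only [h1, Finset.sum_const, nsmul_eq_mul, fixCount, mul_one]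

end FixedVertices

/-! ### Extinction of fixed vertices: one step of the martingale -/

section Extinction

variable {d m : ℕ} {H : Subgroup (Equiv.Perm (Fin d))}

theorem act_ev_eq_self {E : Type*} {b : E → W H} {l : List (E × Bool)} {v : Vertex d}
    (h : ∀ x ∈ l.map Prod.fst, (b x).act v = v) : (ev b l).act v = v := by
  induction l with
  | nil => rfl
  | cons a l ih =>
    rw [ev_cons, W.act_mul]
    have h1 := h a.1 (by simp)
    have h2 : (bif a.2 then b a.1 else (b a.1)⁻¹).act v = v := by
      cases a.2
      · have := W.act_inv_act (b a.1) v
        rwa [h1] at this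
      · exact h1
    rw [h2]
    exact ih fun x hx => h x (by simp at hx ⊢; tauto)

theorem length_edges {X : Type*} (σ : Fin m → Equiv.Perm X) (x : X) (w : List (Fin m × Bool)) :
    (edges σ x w).length = w.length := by
  induction w generalizing x with
  | nil => rfl
  | cons s w ih => simp [edges, ih]

/-- If all labels on the closed paths at the fixed vertices fix the first level, then every child of
a fixed vertex is fixed. These are at most `fixCount σ w * w.length` independent conditions. -/
theorem pow_le_measure_nextFix {n : ℕ} (σ : Fin m → Equiv.Perm (Lv d n))
    (w : List (Fin m × Bool)) :
    haar H {g | ∀ a, g.act [a] = [a]} ^ (fixCount σ w * w.length) ≤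
      Measure.pi (fun _ : Lv d n × Fin m => haar H) {b | nextFix σ w b = d * fixCount σ w} := by
  classical
  set p := haar H {g | ∀ a, g.act [a] = [a]} with hp
  let J : Finset (Lv d n × Fin m) :=
    (Finset.univ.filter fun x => walk σ x w = x).biUnion fun x => (edges σ x w).toFinset
  have hJ : J.card ≤ fixCount σ w * w.length := by
    refine Finset.card_biUnion_le_card_mul _ _ _ fun x _ => ?_
    rw [← length_edges σ x w]
    exact List.toFinset_card_le _
  let s : Lv d n × Fin m → Set (W H) := fun e => if e ∈ J then {g | ∀ a, g.act [a] = [a]} else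
    Set.univ
  have hs : Measure.pi (fun _ : Lv d n × Fin m => haar H) (Set.pi Set.univ s) = p ^ J.card := by
    rw [Measure.pi_pi]
    have : ∀ e, haar H (s e) = if e ∈ J then p else 1 := by
      intro e
      simp only [s]
      split_ifs
      · rfl
      · exact measure_univ
    simp only [this, Finset.prod_ite_mem, Finset.univ_inter, Finset.prod_const]
  refine (pow_le_pow_right_of_le_one' (prob_le_one) hJ).trans ?_
  rw [← hs]
  refine measure_mono fun b hb => ?_
  have hbJ : ∀ e ∈ J, ∀ a, (b e).act [a] = [a] := by
    intro e he
    have := hb e (Set.mem_univ e)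
    simpa [s, he] using this
  simp only [Set.mem_ofPred_eq, nextFix, fixCount]
  rw [mul_comm, ← smul_eq_mul]
  refine Finset.sum_eq_card_nsmul fun x hx => ?_
  rw [Finset.filter_true_of_mem]
  · simp
  · intro a _
    refine act_ev_eq_self fun e he => hbJ e ?_ a
    rw [map_fst_spath] at he
    exact Finset.mem_biUnion.2 ⟨x, hx, List.mem_toFinset.2 he⟩

/-- A bounded and strictly convex function of the number of fixed vertices. -/
noncomputable def potential (k : ℕ) : ENNReal := ENNReal.ofReal (1 / (1 + k))

theorem potential_le_one (k : ℕ) : potential k ≤ 1 := by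
  rw [potential, ENNReal.ofReal_le_one]
  exact div_le_one_of_le₀ (by linarith [Nat.cast_nonneg (α := ℝ) k]) (by positivity)

/-- The gain of the potential when `k` jumps to `d * k`. -/
noncomputable def gap (d k : ℕ) : ENNReal :=
  ENNReal.ofReal (((d * k : ℕ) - k : ℝ) ^ 2 / ((1 + k) ^ 2 * (1 + (d * k : ℕ))))

theorem gap_pos {k : ℕ} (hd : 2 ≤ d) (hk : 1 ≤ k) : 0 < gap d k := by
  rw [gap, ENNReal.ofReal_pos]
  have h1 : (k : ℝ) < (d * k : ℕ) := by
    exact_mod_cast (by nlinarith : k < d * k)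
  have : (0 : ℝ) < (d * k : ℕ) - k := by linarith
  positivity

/-- The expansion of `1 / (1 + x)` about `k` with its exact remainder. The linear term has negative
slope and is moved across, to avoid subtraction in `ENNReal`. -/
theorem potential_add (k j : ℕ) :
    potential j + ENNReal.ofReal (1 / (1 + k) ^ 2) * j =
      potential k + ENNReal.ofReal (1 / (1 + k) ^ 2) * k +
        ENNReal.ofReal (((j : ℝ) - k) ^ 2 / ((1 + k) ^ 2 * (1 + j))) := by
  rw [potential, potential, ← ENNReal.ofReal_natCast j, ← ENNReal.ofReal_natCast k,
    ← ENNReal.ofReal_mul (by positivity), ← ENNReal.ofReal_mul (by positivity),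
    ← ENNReal.ofReal_add (by positivity) (by positivity),
    ← ENNReal.ofReal_add (by positivity) (by positivity),
    ← ENNReal.ofReal_add (by positivity) (by positivity)]
  congr 1
  have h1 : (1 + j : ℝ) ≠ 0 := by positivity
  have h2 : (1 + k : ℝ) ≠ 0 := by positivity
  field_simp
  ring

/-- A quantitative Jensen inequality. The linear terms cancel by the martingale property, and the
convexity remainder is kept only on the event of a jump to `d * k`. -/
theorem potential_add_le_lintegral [MulAction.IsPretransitive H (Fin d)] (hd : 0 < d) {n : ℕ}
    {σ : Fin m → Equiv.Perm (Lv d n)} {s : Fin m × Bool} {w : List (Fin m × Bool)}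
    (hG : Girth σ w.length) (hw : FreeGroup.IsReduced (s :: w)) :
    potential (fixCount σ (s :: w)) + gap d (fixCount σ (s :: w)) *
        haar H {g | ∀ a, g.act [a] = [a]} ^ (fixCount σ (s :: w) * (s :: w).length) ≤
      ∫⁻ b, potential (nextFix (H := H) σ (s :: w) b) ∂(Measure.pi fun _ => haar H) := by
  set k := fixCount σ (s :: w) with hk
  set c := ENNReal.ofReal (1 / (1 + k) ^ 2) with hc
  set S : Set (Lv d n × Fin m → W H) := {b | nextFix σ (s :: w) b = d * k} with hS
  have hmY := measurable_nextFix (H := H) σ (s :: w)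
  have hmS : MeasurableSet S := hmY (measurableSet_singleton _)
  have hmF : Measurable fun b : Lv d n × Fin m → W H => potential (nextFix σ (s :: w) b) :=
    (measurable_of_countable potential).comp hmY
  have h1 : ∫⁻ b, (potential k + c * k + S.indicator (fun _ => gap d k) b)
      ∂(Measure.pi fun _ : Lv d n × Fin m => haar H) ≤
      ∫⁻ b, (potential (nextFix (H := H) σ (s :: w) b) + c * (nextFix (H := H) σ (s :: w) b : ENNReal))
      ∂(Measure.pi fun _ => haar H) := by
    refine lintegral_mono fun b => ?_
    rw [hc, potential_add k (nextFix (H := H) σ (s :: w) b)]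
    gcongr
    by_cases hb : b ∈ S
    · rw [Set.indicator_of_mem hb]
      have hb' : nextFix σ (s :: w) b = d * k := hb
      rw [hb', gap]
    · rw [Set.indicator_of_notMem hb]
      exact zero_le
  have hmc : Measurable fun b : Lv d n × Fin m → W H => (nextFix σ (s :: w) b : ENNReal) :=
    (measurable_of_countable (fun j : ℕ => (j : ENNReal))).comp hmY
  rw [lintegral_add_left measurable_const, lintegral_const, measure_univ, mul_one,
    lintegral_indicator_const hmS, lintegral_add_left hmF, lintegral_const_mul _ hmc,
    lintegral_nextFix hd hG hw, ← hk, add_right_comm] at h1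
  have h2 := (ENNReal.add_le_add_iff_right
    (ENNReal.mul_ne_top ENNReal.ofReal_ne_top (ENNReal.natCast_ne_top k))).1 h1
  refine le_trans ?_ h2
  gcongr
  exact pow_le_measure_nextFix σ (s :: w)

/-! ### Levels of large girth -/

theorem act_take (g : W H) (v : Vertex d) (n : ℕ) : g.act (v.take n) = (g.act v).take n := by
  conv_rhs => rw [← List.take_append_drop n v]
  rw [W.act_append]
  rcases le_total n v.length with h | h
  · rw [List.take_left']
    rw [W.length_act, List.length_take, min_eq_left h]
  · rw [List.drop_eq_nil_of_le h, List.take_of_length_le h]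
    have : (g.cocycle v).act [] = [] := List.length_eq_zero_iff.1 (W.length_act _ _)
    rw [this, List.append_nil, List.take_of_length_le (by rw [W.length_act]; exact h)]

theorem walk_lev_take (φ : Sample m H) {n k : ℕ} (hk : k ≤ n) (x : Lv d n)
    (w : List (Fin m × Bool)) :
    (walk (lev φ k) ⟨x.1.take k, by simp [x.2, hk]⟩ w).1 = (walk (lev φ n) x w).1.take k := by
  rw [walk_lev, walk_lev, act_take]

theorem exists_take_eq (hd : 0 < d) {n k : ℕ} (hk : k ≤ n) (y : Lv d k) :
    ∃ x : Lv d n, x.1.take k = y := by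
  refine ⟨⟨y.1 ++ List.replicate (n - k) ⟨0, hd⟩, by simp [y.2, hk]⟩, ?_⟩
  exact List.take_left' y.2

theorem girth_lev_mono (φ : Sample m H) {n k R : ℕ} (hk : k ≤ n) (h : Girth (lev φ k) R) :
    Girth (lev φ n) R := by
  intro w hw h0 hl x hx
  refine h w hw h0 hl ⟨x.1.take k, by simp [x.2, hk]⟩ (Subtype.ext ?_)
  rw [walk_lev_take φ hk, hx]

/-- The action on level `n` determines the action on prefixes. A girth condition on level `k` is
thus independent of the labels on level `n`. -/
theorem exists_girth_iff (hd : 0 < d) {n k : ℕ} (hk : k ≤ n) (R : ℕ) :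
    ∃ q : (Fin m → Equiv.Perm (Lv d n)) → Prop,
      ∀ φ : Sample m H, Girth (lev φ k) R ↔ q (lev φ n) := by
  refine ⟨fun σ => ∀ w : List (Fin m × Bool), FreeGroup.IsReduced w → w ≠ [] → w.length ≤ R →
    ∀ x, (walk σ x w).1.take k ≠ x.1.take k, fun φ => ⟨?_, ?_⟩⟩
  · intro h w hw h0 hl x hx
    refine h w hw h0 hl ⟨x.1.take k, by simp [x.2, hk]⟩ (Subtype.ext ?_)
    rw [walk_lev_take φ hk, hx]
  · intro h w hw h0 hl y hy
    obtain ⟨x, hx⟩ := exists_take_eq hd hk y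
    refine h w hw h0 hl x ?_
    rw [← walk_lev_take φ hk]
    have : (⟨x.1.take k, by simp [x.2, hk]⟩ : Lv d k) = y := Subtype.ext hx
    rw [this, hy, hx]

theorem setLIntegral_fixCount_succ (hd : 0 < d) {n k : ℕ} (hk : k ≤ n) (R : ℕ)
    (w : List (Fin m × Bool)) (F : ℕ → ENNReal) :
    ∫⁻ φ in {φ : Sample m H | Girth (lev φ k) R}, F (fixCount (lev φ (n + 1)) w) ∂(law m H) =
      ∫⁻ φ in {φ : Sample m H | Girth (lev φ k) R},
        (∫⁻ b, F (nextFix (H := H) (lev φ n) w b) ∂(Measure.pi fun _ => haar H)) ∂(law m H) := by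
  classical
  obtain ⟨q, hq⟩ := exists_girth_iff (m := m) (H := H) hd hk R
  have hS : MeasurableSet {φ : Sample m H | Girth (lev φ k) R} := measurableSet_lev k fun σ => Girth σ R
  have h := lintegral_lev_bfun (H := H) n
    (f := fun σ b => if q σ then F (nextFix σ w b) else 0) (fun σ => by
      split_ifs
      · exact (measurable_of_countable F).comp (measurable_nextFix σ w)
      · exact measurable_const)
  rw [← lintegral_indicator hS, ← lintegral_indicator hS]
  convert h using 3 with φ φ
  · by_cases hφ : q (lev φ n)
    · rw [Set.indicator_of_mem ((hq φ).2 hφ), if_pos hφ, fixCount_succ]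
    · rw [Set.indicator_of_notMem (fun h => hφ ((hq φ).1 h)), if_neg hφ]
  · by_cases hφ : q (lev φ n)
    · rw [Set.indicator_of_mem ((hq φ).2 hφ)]
      simp [hφ]
    · rw [Set.indicator_of_notMem (fun h => hφ ((hq φ).1 h))]
      simp [hφ]

end Extinction

/-! ### Extinction of fixed vertices and growth of the girth -/

section Extinction

variable {d m : ℕ} {H : Subgroup (Equiv.Perm (Fin d))}

/-- A sequence of counting variables with bounded means and with increments of a bounded potential
that are bounded from below on each positive value almost surely reaches zero. -/
theorem measure_forall_ne_zero_of_potential {Ω : Type*} [MeasurableSpace Ω] {μ : Measure Ω}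
    [IsProbabilityMeasure μ] {S : Set Ω} {M : ℕ → Ω → ℕ}
    (hM : ∀ n, Measurable (M n)) {J : ENNReal} (hJ : J ≠ ⊤)
    (hmean : ∀ n, ∫⁻ ω in S, (M n ω : ENNReal) ∂μ ≤ J) {c : ℕ → ENNReal}
    (hc : ∀ k, 1 ≤ k → c k ≠ 0)
    (hpot : ∀ n k, ∫⁻ ω in S, potential (M n ω) ∂μ + c k * μ (S ∩ {ω | M n ω = k}) ≤
      ∫⁻ ω in S, potential (M (n + 1) ω) ∂μ) :
    μ (S ∩ {ω | ∀ n, M n ω ≠ 0}) = 0 := by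
  have hlim : ∀ k, 1 ≤ k → Filter.Tendsto (fun n => μ (S ∩ {ω | M n ω = k})) Filter.atTop
      (nhds 0) := by
    intro k hk
    refine ENNReal.tendsto_atTop_zero_of_tsum_ne_top ?_
    -- The increments telescope against a potential bounded by one, so the probabilities of the
    -- value `k` are summable and tend to zero.
    have h1 : ∀ n, ∑ i ∈ Finset.range n, c k * μ (S ∩ {ω | M i ω = k}) ≤
        ∫⁻ ω in S, potential (M n ω) ∂μ := by
      intro n
      induction n with
      | zero => simp
      | succ n ih =>
        rw [Finset.sum_range_succ]
        exact (add_le_add_left ih _).trans (hpot n k)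
    have h2 : ∑' i, c k * μ (S ∩ {ω | M i ω = k}) ≤ 1 := by
      refine ENNReal.tsum_le_of_sum_range_le fun n => (h1 n).trans ?_
      calc ∫⁻ ω in S, potential (M n ω) ∂μ ≤ ∫⁻ _ in S, 1 ∂μ :=
            lintegral_mono fun ω => potential_le_one _
        _ = μ S := by simp
        _ ≤ 1 := prob_le_one
    rw [ENNReal.tsum_mul_left] at h2
    intro htop
    rw [htop, ENNReal.mul_top (hc k hk)] at h2
    simp at h2
  set x := μ (S ∩ {ω | ∀ n, M n ω ≠ 0}) with hx
  -- A positive value is either at most `B`, with probability tending to zero, or at least `B + 1`,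
  -- with probability at most `J / (B + 1)` by Markov's inequality.
  have hbound : ∀ B : ℕ, ((B + 1 : ℕ) : ENNReal) * x ≤ J := by
    intro B
    have hB : ((B + 1 : ℕ) : ENNReal) ≠ 0 := by simp
    have hB' : ((B + 1 : ℕ) : ENNReal) ≠ ⊤ := ENNReal.natCast_ne_top _
    have h1 : ∀ n, x ≤ ∑ k ∈ Finset.Icc 1 B, μ (S ∩ {ω | M n ω = k}) + J / (B + 1 : ℕ) := by
      intro n
      have h2 : S ∩ {ω | ∀ n, M n ω ≠ 0} ⊆
          (⋃ k ∈ Finset.Icc 1 B, S ∩ {ω | M n ω = k}) ∪ {ω | B + 1 ≤ M n ω} ∩ S := by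
        rintro ω ⟨h, h'⟩
        have h3 := h' n
        rcases lt_or_ge B (M n ω) with h4 | h4
        · exact Or.inr ⟨h4, h⟩
        · refine Or.inl (Set.mem_biUnion (x := M n ω) ?_ ⟨h, rfl⟩)
          simp only [Finset.coe_Icc, Set.mem_Icc]
          exact ⟨Nat.one_le_iff_ne_zero.2 h3, h4⟩
      refine (measure_mono h2).trans ((measure_union_le _ _).trans ?_)
      refine add_le_add (measure_biUnion_finset_le _ _) ?_
      rw [ENNReal.le_div_iff_mul_le (Or.inl hB) (Or.inl hB'), mul_comm]
      refine le_trans ?_ (hmean n)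
      have hms : MeasurableSet {ω | B + 1 ≤ M n ω} := hM n measurableSet_Ici
      rw [← Measure.restrict_apply hms]
      have h4 := mul_meas_ge_le_lintegral (μ := μ.restrict S)
        ((measurable_of_countable (fun j : ℕ => (j : ENNReal))).comp (hM n)) ((B + 1 : ℕ) : ENNReal)
      simpa only [Function.comp_apply, Nat.cast_le] using h4
    have h2 : Filter.Tendsto
        (fun n => ∑ k ∈ Finset.Icc 1 B, μ (S ∩ {ω | M n ω = k}) + J / (B + 1 : ℕ)) Filter.atTop
        (nhds (0 + J / (B + 1 : ℕ))) := by
      refine Filter.Tendsto.add ?_ tendsto_const_nhds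
      rw [← Finset.sum_const_zero (s := Finset.Icc 1 B)]
      exact tendsto_finsetSum _ fun k hk => hlim k (Finset.mem_Icc.1 hk).1
    have h3 := ge_of_tendsto' h2 h1
    rw [zero_add, ENNReal.le_div_iff_mul_le (Or.inl hB) (Or.inl hB'), mul_comm] at h3
    exact h3
  by_contra h0
  obtain ⟨n, hn⟩ := ENNReal.exists_nat_mul_gt h0 hJ
  refine absurd (hn.trans_le (le_trans ?_ (hbound n))) (lt_irrefl _)
  gcongr
  exact Nat.le_succ n

theorem fixCount_eq_zero_iff {n : ℕ} {σ : Fin m → Equiv.Perm (Lv d n)}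
    {w : List (Fin m × Bool)} : fixCount σ w = 0 ↔ ∀ x, walk σ x w ≠ x := by
  simp [fixCount, Finset.filter_eq_empty_iff]

theorem measurable_fixCount (n : ℕ) (w : List (Fin m × Bool)) :
    Measurable fun φ : Sample m H => fixCount (lev φ n) w :=
  measurable_to_countable' fun k => measurableSet_lev n fun σ => fixCount σ w = k

theorem fixCount_le {n : ℕ} (σ : Fin m → Equiv.Perm (Lv d n)) (w : List (Fin m × Bool)) :
    fixCount σ w ≤ Fintype.card (Lv d n) := Finset.card_le_univ _

theorem law_forall_fixCount_ne_zero [MulAction.IsPretransitive H (Fin d)] (hd : 2 ≤ d) (k : ℕ)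
    {s : Fin m × Bool} {w : List (Fin m × Bool)} (hw : FreeGroup.IsReduced (s :: w)) :
    law m H ({φ | Girth (lev φ k) w.length} ∩ {φ | ∀ n, fixCount (lev φ (k + n)) (s :: w) ≠ 0}) =
      0 := by
  have hS : MeasurableSet {φ : Sample m H | Girth (lev φ k) w.length} :=
    measurableSet_lev k fun σ => Girth σ w.length
  have hd0 : 0 < d := by omega
  refine measure_forall_ne_zero_of_potential (fun n => measurable_fixCount (k + n) (s :: w))
    (J := Fintype.card (Lv d k)) (ENNReal.natCast_ne_top _) ?_
    (c := fun j => gap d j * haar H {g | ∀ a, g.act [a] = [a]} ^ (j * (s :: w).length)) ?_ ?_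
  · intro n
    induction n with
    | zero =>
      calc ∫⁻ φ in {φ : Sample m H | Girth (lev φ k) w.length},
            (fixCount (lev φ (k + 0)) (s :: w) : ENNReal) ∂(law m H)
          ≤ ∫⁻ φ in {φ : Sample m H | Girth (lev φ k) w.length},
            (Fintype.card (Lv d k) : ENNReal) ∂(law m H) :=
            lintegral_mono fun φ => Nat.cast_le.2 (fixCount_le _ _)
        _ ≤ Fintype.card (Lv d k) := by
            rw [lintegral_const, Measure.restrict_apply_univ]
            exact mul_le_of_le_one_right' prob_le_one
    | succ n ih =>
      refine le_trans (le_of_eq ?_) ih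
      rw [← add_assoc, setLIntegral_fixCount_succ hd0 (Nat.le_add_right k n) _ _
        (fun j => (j : ENNReal))]
      refine setLIntegral_congr_fun hS fun φ hφ => ?_
      exact lintegral_nextFix hd0 (girth_lev_mono φ (Nat.le_add_right k n) hφ) hw
  · intro j hj
    exact mul_ne_zero (gap_pos hd hj).ne' (pow_ne_zero _ haar_fix_pos.ne')
  · intro n j
    rw [← add_assoc, setLIntegral_fixCount_succ hd0 (Nat.le_add_right k n) _ _ potential]
    have hE : MeasurableSet {φ : Sample m H | fixCount (lev φ (k + n)) (s :: w) = j} :=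
      measurableSet_lev (k + n) fun σ => fixCount σ (s :: w) = j
    set c := gap d j * haar H {g | ∀ a, g.act [a] = [a]} ^ (j * (s :: w).length)
    have h1 : c * law m H ({φ | Girth (lev φ k) w.length} ∩
        {φ | fixCount (lev φ (k + n)) (s :: w) = j}) =
        ∫⁻ φ in {φ : Sample m H | Girth (lev φ k) w.length},
          {φ : Sample m H | fixCount (lev φ (k + n)) (s :: w) = j}.indicator (fun _ => c) φ
          ∂(law m H) := by
      rw [lintegral_indicator_const hE, Measure.restrict_apply hE, Set.inter_comm]
    have hmp : Measurable fun φ : Sample m H => potential (fixCount (lev φ (k + n)) (s :: w)) :=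
      (measurable_of_countable potential).comp (measurable_fixCount (k + n) (s :: w))
    rw [h1, ← lintegral_add_left hmp]
    refine setLIntegral_mono' hS fun φ hφ => ?_
    refine le_trans ?_ (potential_add_le_lintegral hd0
      (girth_lev_mono φ (Nat.le_add_right k n) hφ) hw)
    gcongr
    simp only [Set.indicator_apply, Set.mem_ofPred_eq]
    split_ifs with hj
    · rw [hj]
    · exact zero_le

theorem forall_walk_ne_mono (φ : Sample m H) {n k : ℕ} (hk : k ≤ n) {w : List (Fin m × Bool)}
    (h : ∀ x, walk (lev φ k) x w ≠ x) : ∀ x, walk (lev φ n) x w ≠ x := by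
  intro x hx
  refine h ⟨x.1.take k, by simp [x.2, hk]⟩ (Subtype.ext ?_)
  rw [walk_lev_take φ hk, hx]

/-- Almost surely, the girth of the Schreier graphs tends to infinity. -/
theorem ae_exists_girth [MulAction.IsPretransitive H (Fin d)] (hd : 2 ≤ d) (R : ℕ) :
    ∀ᵐ φ ∂(law m H), ∃ n, Girth (lev φ n) R := by
  induction R with
  | zero =>
    refine Filter.Eventually.of_forall fun φ => ⟨0, fun w _ h0 hl => ?_⟩
    exact absurd (List.length_eq_zero_iff.1 (Nat.le_zero.1 hl)) h0
  | succ R ih =>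
    -- The level `k` on which words of length at most `R` already have no fixed vertices is random,
    -- so extinction is applied for all `k` at once.
    have h1 : ∀ w ∈ wordsLE m (R + 1), ∀ᵐ φ ∂(law m H), FreeGroup.IsReduced w → w.length = R + 1 →
        ∃ n, ∀ x, walk (lev φ n) x w ≠ x := by
      intro w _
      by_cases hw : FreeGroup.IsReduced w ∧ w.length = R + 1
      · obtain ⟨s, w', rfl⟩ : ∃ s w', w = s :: w' :=
          List.exists_cons_of_length_eq_add_one hw.2
        have hl : w'.length = R := by simpa using hw.2
        have h2 : ∀ k, ∀ᵐ φ ∂(law m H), ¬ (Girth (lev φ k) R ∧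
            ∀ n, fixCount (lev φ (k + n)) (s :: w') ≠ 0) := by
          intro k
          have := law_forall_fixCount_ne_zero (H := H) hd k hw.1
          rw [hl] at this
          rw [ae_iff]
          simpa only [not_not, Set.ofPred_and] using this
        filter_upwards [ih, ae_all_iff.2 h2] with φ hφ hφ2 _ _
        obtain ⟨k, hk⟩ := hφ
        have h3 := hφ2 k
        push Not at h3
        obtain ⟨n, hn⟩ := h3 hk
        exact ⟨k + n, fixCount_eq_zero_iff.1 hn⟩
      · exact Filter.Eventually.of_forall fun φ h h' => absurd ⟨h, h'⟩ hw
    have h2 := (Filter.eventually_all_finset (wordsLE m (R + 1))).2 h1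
    filter_upwards [ih, h2] with φ ⟨k, hk⟩ hφ
    have h3 : ∀ w : List (Fin m × Bool), ∃ n, w ∈ wordsLE m (R + 1) → FreeGroup.IsReduced w →
        w.length = R + 1 → ∀ x, walk (lev φ n) x w ≠ x := by
      intro w
      by_cases hw : w ∈ wordsLE m (R + 1) ∧ FreeGroup.IsReduced w ∧ w.length = R + 1
      · obtain ⟨n, hn⟩ := hφ w hw.1 hw.2.1 hw.2.2
        exact ⟨n, fun _ _ _ => hn⟩
      · exact ⟨0, fun h h' h'' => absurd ⟨h, h', h''⟩ hw⟩
    choose f hf using h3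
    refine ⟨max k ((wordsLE m (R + 1)).sup f), fun w hw h0 hl x => ?_⟩
    rcases Nat.lt_or_ge w.length (R + 1) with h | h
    · exact girth_lev_mono φ (le_max_left _ _) hk w hw h0 (Nat.lt_succ_iff.1 h) x
    · have hmem : w ∈ wordsLE m (R + 1) := mem_wordsLE.2 hl
      exact forall_walk_ne_mono φ ((Finset.le_sup hmem).trans (le_max_right _ _))
        (hf w hmem hw (le_antisymm hl h)) x

end Extinction

/-! ### The stopping level and the conditional law -/

section Main

variable {d m : ℕ} {H : Subgroup (Equiv.Perm (Fin d))}

theorem measure_eq_of_subsingleton {Ω : Type*} [MeasurableSpace Ω] [Subsingleton Ω]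
    (μ ν : Measure Ω) [IsProbabilityMeasure μ] [IsProbabilityMeasure ν] : μ = ν := by
  ext s _
  rcases Subsingleton.set_cases (p := fun s => s = ∅ ∨ s = Set.univ) (Or.inl rfl) (Or.inr rfl) s
    with rfl | rfl <;> simp

theorem subsingleton_W (hd : d < 2) : Subsingleton (W H) := by
  have : Subsingleton (Fin d) := Fin.subsingleton_iff_le_one.2 (by omega)
  refine ⟨fun g h => W.ext_act fun v => ?_⟩
  exact List.ext_getElem (by rw [W.length_act, W.length_act]) fun i _ _ => Subsingleton.elim _ _

theorem nonempty_of_not_isCyclic {Δ : Subgroup (FreeGroup (Fin m))} (hΔ : ¬ IsCyclic Δ) :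
    Nonempty (Fin m) := by
  by_contra h
  rw [not_nonempty_iff] at h
  exact hΔ inferInstance

theorem count_map_injective {α β : Type*} [BEq α] [LawfulBEq α] [BEq β] [LawfulBEq β]
    {f : α → β} (hf : Function.Injective f) (l : List α) (a : α) :
    (l.map f).count (f a) = l.count a := by
  induction l with
  | nil => rfl
  | cons b l ih =>
    rw [List.map_cons, List.count_cons, List.count_cons, ih]
    by_cases h : b = a
    · simp [h]
    · simp [h, hf.ne h]

/-- This reconciles counts made with classical and with derived equality tests. -/
theorem count_eq_count {α : Type*} (i j : BEq α) (hi : @LawfulBEq α i) (hj : @LawfulBEq α j)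
    (l : List α) (a : α) : @List.count α i a l = @List.count α j a l := by
  have h := @count_map_injective α α i hi j hj id Function.injective_id l a
  rw [← h, List.map_id, id]

/-- The first level on which the Schreier graph has girth larger than `R`, and zero if there is no
such level. -/
noncomputable def girthLevel (R : ℕ) (φ : Sample m H) : ℕ :=
  open scoped Classical in
  if h : ∃ n, Girth (lev φ n) R then Nat.find h else 0

theorem girth_girthLevel {R n : ℕ} {φ : Sample m H} (h : Girth (lev φ n) R) :
    Girth (lev φ (girthLevel R φ)) R := by
  classical
  rw [girthLevel, dif_pos ⟨n, h⟩]
  exact Nat.find_spec (p := fun n => Girth (lev φ n) R) ⟨n, h⟩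

theorem girthLevel_eq_iff {R n : ℕ} {φ : Sample m H} (h : Girth (lev φ n) R) :
    girthLevel R φ = n ↔ ∀ k < n, ¬ Girth (lev φ k) R := by
  classical
  rw [girthLevel, dif_pos ⟨n, h⟩, Nat.find_eq_iff]
  exact and_iff_right h

theorem measurableSet_girthLevel_eq (R n : ℕ) :
    MeasurableSet {φ : Sample m H | girthLevel R φ = n} := by
  have hG : ∀ k, MeasurableSet {φ : Sample m H | Girth (lev φ k) R} := fun k =>
    measurableSet_lev k fun σ => Girth σ R
  have h : {φ : Sample m H | girthLevel R φ = n} =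
      ({φ | Girth (lev φ n) R} ∩ ⋂ k ∈ Set.Iio n, {φ | Girth (lev φ k) R}ᶜ) ∪
        ({_φ | n = 0} ∩ ⋂ k, {φ | Girth (lev φ k) R}ᶜ) := by
    ext φ
    simp only [Set.mem_ofPred_eq, Set.mem_union, Set.mem_inter_iff, Set.mem_iInter,
      Set.mem_compl_iff, Set.mem_Iio]
    constructor
    · rintro rfl
      by_cases hφ : ∃ k, Girth (lev φ k) R
      · obtain ⟨k, hk⟩ := hφ
        have := girth_girthLevel hk
        exact Or.inl ⟨this, (girthLevel_eq_iff this).1 rfl⟩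
      · exact Or.inr ⟨by rw [girthLevel, dif_neg hφ], fun k hk => hφ ⟨k, hk⟩⟩
    · rintro (⟨h1, h2⟩ | ⟨rfl, h2⟩)
      · exact (girthLevel_eq_iff h1).2 h2
      · rw [girthLevel, dif_neg fun ⟨k, hk⟩ => h2 k hk]
  rw [h]
  exact ((hG n).inter (MeasurableSet.biInter (Set.to_countable _) fun k _ => (hG k).compl)).union
    ((MeasurableSet.const _).inter (MeasurableSet.iInter fun k => (hG k).compl))

/-- The stopping time property: the girths of all earlier levels can be read off from level `n`. -/
theorem girthLevel_congr (hd : 0 < d) {R n : ℕ} {φ ψ : Sample m H} (h : Girth (lev φ n) R)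
    (he : lev φ n = lev ψ n) (hn : girthLevel R φ = n) : girthLevel R ψ = n := by
  rw [girthLevel_eq_iff h] at hn
  refine (girthLevel_eq_iff (he ▸ h)).2 fun k hk hG => hn k hk ?_
  obtain ⟨q, hq⟩ := exists_girth_iff (m := m) (H := H) hd hk.le R
  rw [hq, he, ← hq]
  exact hG

theorem measurableSet_girthLevel_lev (R : ℕ)
    (p : ∀ n, (Fin m → Equiv.Perm (Lv d n)) → Prop) :
    MeasurableSet {φ : Sample m H | p (girthLevel R φ) (lev φ (girthLevel R φ))} := by
  have h : {φ : Sample m H | p (girthLevel R φ) (lev φ (girthLevel R φ))} =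
      ⋃ n, {φ | girthLevel R φ = n} ∩ {φ | p n (lev φ n)} := by
    ext φ
    simp only [Set.mem_ofPred_eq, Set.mem_iUnion, Set.mem_inter_iff]
    exact ⟨fun h => ⟨_, rfl, h⟩, by rintro ⟨n, rfl, h⟩; exact h⟩
  rw [h]
  exact MeasurableSet.iUnion fun n =>
    (measurableSet_girthLevel_eq R n).inter (measurableSet_lev n (p n))

theorem exists_mem_levelOrbits {φ : Sample m H} {Δ : Subgroup (FreeGroup (Fin m))} {n : ℕ}
    {Z : Set (Vertex d)} (hZ : Z ∈ levelOrbits φ Δ n) :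
    ∃ x₀ : Lv d n, Z = {y | ∃ δ ∈ Δ, y = (walk (lev φ n) x₀ δ.toWord).1} := by
  obtain ⟨x, hx, rfl⟩ := hZ
  refine ⟨⟨x, hx⟩, ?_⟩
  simp only [walk_lev, FreeGroup.mk_toWord]

/-- Conditionally on the level action the labels are independent Haar elements, and the words read
along the loops have private letters. -/
theorem iIndepFun_cocycle {n K : ℕ} {σ : Fin m → Equiv.Perm (Lv d n)} (x : Lv d n)
    (w : Fin K → List (Fin m × Bool)) (e : Fin K → Lv d n × Fin m)
    (hw : ∀ j k, (edges σ x (w j)).count (e k) = if j = k then 1 else 0)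
    (h0 : law m H {φ | lev φ n = σ} ≠ 0) :
    iIndepFun (fun k (φ : Sample m H) => ev (bfun φ n) (spath σ x (w k)))
        (cond (law m H) {φ | lev φ n = σ}) ∧
      ∀ k, Measure.map (fun φ : Sample m H => ev (bfun φ n) (spath σ x (w k)))
        (cond (law m H) {φ | lev φ n = σ}) = haar H := by
  classical
  have h1 := (measurePreserving_ev (μ := haar H) (e := e) (l := fun k => spath σ x (w k)) (by
    intro k j
    rw [map_fst_spath, ← hw k j]
    exact count_eq_count _ _ inferInstance inferInstance _ _)).comp (map_bfun_cond n σ h0)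
  have h2 : ∀ k, MeasurePreserving (fun φ : Sample m H => ev (bfun φ n) (spath σ x (w k)))
      (cond (law m H) {φ | lev φ n = σ}) (haar H) := fun k =>
    (measurePreserving_eval (fun _ : Fin K => haar H) k).comp h1
  have := cond_isProbabilityMeasure h0
  refine ⟨?_, fun k => (h2 k).map_eq⟩
  rw [iIndepFun_iff_map_fun_eq_pi_map fun k => (h2 k).measurable.aemeasurable]
  simp only [(h2 _).map_eq]
  exact h1.map_eq

end Main

end RandomTree

theorem theorem3p1 (d m K : ℕ) (H : Subgroup (Equiv.Perm (Fin d)))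
    [MulAction.IsPretransitive H (Fin d)] (Δ : Subgroup (FreeGroup (Fin m)))
    (hΔ : ¬ IsCyclic Δ) :
    ∃ (N : Sample m H → ℕ)
      (v : Sample m H → Set (Vertex d) → Vertex d)
      (α : Sample m H → Set (Vertex d) → Fin K → FreeGroup (Fin m))
      (e : Sample m H → Set (Vertex d) → Fin K →
        Vertex d × Fin m),
      -- all of these are random variables (with values in countable discrete sets)
      (∀ n, MeasurableSet {φ | N φ = n}) ∧
      (∀ Z x, MeasurableSet {φ | v φ Z = x}) ∧
      (∀ Z k a, MeasurableSet {φ | α φ Z k = a}) ∧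
      (∀ Z k c, MeasurableSet {φ | e φ Z k = c}) ∧
      -- almost surely `v(Z) ∈ Z` and `α_k(Z) ∈ Δ_{v(Z)}` for all orbits `Z` on the level `N`
      (∀ᵐ φ ∂(law m H), ∀ Z ∈ levelOrbits φ Δ (N φ),
        v φ Z ∈ Z ∧ ∀ k, α φ Z k ∈ Δ ∧ (hom φ (α φ Z k)).act (v φ Z) = v φ Z) ∧
      -- given `N` and the action on the level `N`, for each orbit `Z` on this level the local
      -- cocycles `β(α_k(Z), v(Z))` are independent and distributed according to Haar measure
      (∀ (n : ℕ) (ψ : Sample m H),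
        law m H (levelEvent N n ψ) ≠ 0 →
        ∀ Z ∈ levelOrbits ψ Δ n,
          iIndepFun
            (fun k φ => (hom φ (α φ Z k)).cocycle (v φ Z))
            (cond (law m H) (levelEvent N n ψ)) ∧
          ∀ k, Measure.map
            (fun φ => (hom φ (α φ Z k)).cocycle (v φ Z))
            (cond (law m H) (levelEvent N n ψ)) =
              haar H) ∧
      -- for `d ≥ 2`, almost surely for each orbit `Z` on the level `N`, the closed path at `v(Z)`
      -- in the Schreier graph of the free group on `L(N)` labelled by the reduced word `α_j(Z)`
      -- passes through the geometric edge `e_k(Z)` once if `j = k`, and not at all if `j ≠ k`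
      (2 ≤ d → ∀ᵐ φ ∂(law m H), ∀ Z ∈ levelOrbits φ Δ (N φ), ∀ j k,
        (e φ Z k).1.length = N φ ∧
        (pathEdges φ (v φ Z) (α φ Z j).toWord).count (e φ Z k) =
          if j = k then 1 else 0) := by
  obtain ⟨i₀⟩ := nonempty_of_not_isCyclic hΔ
  rcases Nat.lt_or_ge d 2 with hd | hd
  -- For `d < 2` the group `W(H)` is trivial and level `0` with constant choices suffices.
  · have := subsingleton_W (H := H) hd
    refine ⟨fun _ => 0, fun _ _ => [], fun _ _ _ => 1, fun _ _ _ => ([], i₀),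
      fun _ => MeasurableSet.const _, fun _ _ => MeasurableSet.const _,
      fun _ _ _ => MeasurableSet.const _, fun _ _ _ => MeasurableSet.const _,
      Filter.Eventually.of_forall ?_, ?_, fun h => absurd h (by omega)⟩
    · rintro φ Z ⟨x, hx, rfl⟩
      have hx' : x = [] := List.length_eq_zero_iff.1 hx
      refine ⟨⟨1, Δ.one_mem, ?_⟩, fun _ => ⟨Δ.one_mem, ?_⟩⟩
      · rw [hx', map_one]; rfl
      · rw [map_one]; rfl
    · intro n ψ h0 Z _
      have := cond_isProbabilityMeasure h0
      have hm : ∀ k : Fin K, Measurable fun φ : Sample m H => (hom φ 1).cocycle [] := by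
        intro _
        simp only [map_one]
        exact measurable_const
      have hp : ∀ k : Fin K, IsProbabilityMeasure
          (Measure.map (fun φ : Sample m H => (hom φ 1).cocycle [])
            (cond (law m H) (levelEvent (fun _ => 0) n ψ))) :=
        fun k => Measure.isProbabilityMeasure_map (hm k).aemeasurable
      refine ⟨?_, fun k => ?_⟩
      · rw [iIndepFun_iff_map_fun_eq_pi_map fun k => (hm k).aemeasurable]
        have := Measure.isProbabilityMeasure_map (μ := cond (law m H) (levelEvent (fun _ => 0) n ψ))
          (measurable_pi_lambda (fun (φ : Sample m H) (_ : Fin K) => (hom φ 1).cocycle [])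
            hm).aemeasurable
        exact measure_eq_of_subsingleton _ _
      · have := hp k
        exact measure_eq_of_subsingleton _ _
  · have hd0 : 0 < d := by omega
    obtain ⟨R, hR⟩ := exists_orbit_loops hΔ K
    -- The vertex, the words and the edges are chosen as functions of the level, its action and `Z`
    -- alone, so conditioning on the level action makes them constant.
    have hD : ∀ (n : ℕ) (σ : Fin m → Equiv.Perm (Lv d n)) (Z : Set (Vertex d)),
        ∃ D : Lv d n × (Fin K → FreeGroup (Fin m)) × (Fin K → Lv d n × Fin m),
          Girth σ R → (∃ x₀ : Lv d n, Z = {y | ∃ δ ∈ Δ, y = (walk σ x₀ δ.toWord).1}) →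
          D.1.1 ∈ Z ∧ (∀ k, D.2.1 k ∈ Δ ∧ walk σ D.1 (D.2.1 k).toWord = D.1) ∧
          ∀ j k, (edges σ D.1 (D.2.1 j).toWord).count (D.2.2 k) = if j = k then 1 else 0 := by
      intro n σ Z
      by_cases h : Girth σ R ∧ ∃ x₀ : Lv d n, Z = {y | ∃ δ ∈ Δ, y = (walk σ x₀ δ.toWord).1}
      · obtain ⟨hG, x₀, rfl⟩ := h
        obtain ⟨v, α, e, ⟨δ, hδ, hv⟩, hα, he⟩ := hR (Lv d n) σ hG x₀
        refine ⟨(v, α, e), fun _ _ => ⟨⟨δ, hδ, by rw [hv]⟩, hα, fun j k => ?_⟩⟩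
        rw [← he j k]
        exact count_eq_count _ _ inferInstance inferInstance _ _
      · let x : Lv d n := ⟨List.replicate n ⟨0, hd0⟩, by simp⟩
        exact ⟨(x, 1, fun _ => (x, i₀)), fun h1 h2 => absurd ⟨h1, h2⟩ h⟩
    choose D hD using hD
    refine ⟨girthLevel R, fun φ Z => (D (girthLevel R φ) (lev φ _) Z).1.1,
      fun φ Z => (D (girthLevel R φ) (lev φ _) Z).2.1,
      fun φ Z k => Prod.map Subtype.val id ((D (girthLevel R φ) (lev φ _) Z).2.2 k),
      measurableSet_girthLevel_eq R,
      fun Z x => measurableSet_girthLevel_lev R fun n σ => (D n σ Z).1.1 = x,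
      fun Z k a => measurableSet_girthLevel_lev R fun n σ => (D n σ Z).2.1 k = a,
      fun Z k c => measurableSet_girthLevel_lev R fun n σ =>
        Prod.map Subtype.val id ((D n σ Z).2.2 k) = c, ?_, ?_, fun _ => ?_⟩
    · filter_upwards [ae_exists_girth hd R] with φ ⟨n, hn⟩ Z hZ
      obtain ⟨h1, h2, -⟩ := hD _ (lev φ _) Z (girth_girthLevel hn) (exists_mem_levelOrbits hZ)
      refine ⟨h1, fun k => ⟨(h2 k).1, ?_⟩⟩
      have := walk_lev φ (D (girthLevel R φ) (lev φ _) Z).1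
        ((D (girthLevel R φ) (lev φ _) Z).2.1 k).toWord
      rw [FreeGroup.mk_toWord] at this
      rw [← this, (h2 k).2]
    · intro n ψ h0 Z hZ
      -- `N = 0` may also be the default value, taken when no level has large girth. Positive
      -- probability supplies a sample in the event for which `N` is a genuine level of large girth.
      obtain ⟨φ₀, ⟨hN₀, hφ₀⟩, k, hk⟩ :
          ∃ φ ∈ levelEvent (girthLevel R) n ψ, ∃ k, Girth (lev φ k) R := by
        by_contra! h
        exact h0 (measure_mono_null (fun φ hφ => by simpa using h φ hφ)
          (ae_iff.1 (ae_exists_girth (m := m) (H := H) hd R)))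
      have hlev : lev φ₀ n = lev ψ n := lev_eq_iff.2 hφ₀
      have hG₀ : Girth (lev φ₀ n) R := by
        have := girth_girthLevel hk
        rwa [hN₀] at this
      -- By the stopping time property the condition on `N` is implied by the action on level `n`,
      -- so no further conditioning disturbs the labels.
      have hevent : levelEvent (girthLevel R) n ψ = {φ | lev φ n = lev ψ n} := by
        ext φ
        refine ⟨fun h => lev_eq_iff.2 h.2, fun h => ⟨?_, lev_eq_iff.1 h⟩⟩
        exact girthLevel_congr hd0 hG₀ (hlev.trans (Eq.symm h)) hN₀
      obtain ⟨-, -, h3⟩ := hD n (lev ψ n) Z (hlev ▸ hG₀) (exists_mem_levelOrbits hZ)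
      have hae : ∀ k, (fun φ : Sample m H =>
          ev (bfun φ n) (spath (lev ψ n) (D n (lev ψ n) Z).1 ((D n (lev ψ n) Z).2.1 k).toWord))
          =ᵐ[cond (law m H) (levelEvent (girthLevel R) n ψ)]
          fun φ => (hom φ ((D (girthLevel R φ) (lev φ _) Z).2.1 k)).cocycle
            (D (girthLevel R φ) (lev φ _) Z).1.1 := by
        intro k
        have hms : MeasurableSet (levelEvent (girthLevel R) n ψ) := by
          rw [hevent]
          exact measurableSet_lev_eq n _
        filter_upwards [ae_cond_mem hms] with φ hφ
        rw [hφ.1]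
        have h := lev_eq_iff.2 hφ.2
        rw [← h, ← cocycle_hom, FreeGroup.mk_toWord]
      have h4 := iIndepFun_cocycle (H := H) _ _ _ h3 (hevent ▸ h0)
      rw [← hevent] at h4
      refine ⟨h4.1.congr hae, fun k => ?_⟩
      rw [← h4.2 k]
      exact (Measure.map_congr (hae k)).symm
    · filter_upwards [ae_exists_girth hd R] with φ ⟨n, hn⟩ Z hZ j k
      obtain ⟨-, -, h3⟩ := hD _ (lev φ _) Z (girth_girthLevel hn) (exists_mem_levelOrbits hZ)
      refine ⟨((D (girthLevel R φ) (lev φ _) Z).2.2 k).1.2, ?_⟩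
      rw [pathEdges_eq, ← h3 j k]
      exact count_map_injective (Subtype.val_injective.prodMap Function.injective_id) _ _
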